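/- \textbf{Equivariant Darboux Theorem.} \emph{Conventions.} A chart $(V,G,\pi)$ on a topological space $X$ consists of a connected open set $V\subset\mathbb{R}^d$ (for some $d\ge 0$), a finite group $G$ acting smoothly and effectively on $V$, and a $G$-invariant map $\pi\colon V\to X$ inducing a homeomorphism of $V/G$ onto an open subset $U$ of $X$. An embedding $(V,G,\pi)\hookrightarrow(V',G',\pi')$ is a smooth open embedding $\varphi\colon V\to V'$ together with an injective homomorphism $\lambda\colon G\to G'$ such that $\varphi(g\cdot v)=\lambda(g)\cdot\varphi(v)$ and $\pi'\circ\varphi=\pi$. Two charts are compatible if every $x\in U\cap U'$ lies in the image of a chart, with image contained in $U\cap U'$, that embeds into both. A (boundaryless, smooth, effective) orbifold is a space $X$ with an atlas of pairwise compatible charts covering $X$; its uniformizing charts are all charts compatible with every chart of the atlas. An orbifold $2$-form $\omega$ assigns to each uniformizing chart $(V,G,\pi)$ a smooth $G$-invariant $2$-form $\omega_V$ on $V$ such that $\varphi^*\omega_{V'}=\omega_V$ for every embedding of uniformizing charts. It is symplectic if each $\omega_V$ is closed and non-degenerate. The isotropy group $G_p$ of $p\in X$ is the stabilizer $\{g\in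 G: g\cdot x=x\}$ of a lift $x\in V$ of $p$ in a uniformizing chart $(V,G,\pi)$. \emph{Statement.} Let $X$ be a boundaryless smooth effective orbifold with a symplectic orbifold form $\omega$, let $p\in X$, and let $G_p$ be its isotropy group, computed in any uniformizing chart at any lift of $p$. No compactness or global quotient presentation is assumed. Then there are a uniformizing chart $(V,G,\pi)$ of $X$ with $G\cong G_p$, a point $v_0\in V$ with $\pi(v_0)=p$ that is fixed by all of $G$, an integer $n\ge 0$, and smooth coordinates $(q^1,\dots,q^n,p_1,\dots,p_n)$ on $V$ (a diffeomorphism of $V$ onto an open subset of $\mathbb{R}^{2n}$) taking the value $0$ at $v_0$, such that: \begin{enumerate} \item $\omega_V=\sum_{i=1}^n dp_i\wedge dq^i$ on $V$; \item $G$ acts linearly in these coordinates by symplectic matrices: there is a homomorphism $S\colon G\to\mathrm{Sp}(2n,\mathbb{R})$, $g\mapsto S_g$, such that each $g\in G$ acts as $(q,p)\mapsto S_g(q,p)$. \end{enumerate} -/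

import Mathlib

open scoped ContDiff

/-- `f` restricts to a smooth open embedding of `V`: it is smooth on `V`, its image is open, and it
has a smooth inverse defined on the image. -/
def IsSmoothOpenEmbeddingOn {E F : Type*} [NormedAddCommGroup E] [NormedSpace ℝ E]
    [NormedAddCommGroup F] [NormedSpace ℝ F] (f : E → F) (V : Set E) : Prop :=
  ContDiffOn ℝ ∞ f V ∧ IsOpen (f '' V) ∧
    ∃ h : F → E, ContDiffOn ℝ ∞ h (f '' V) ∧ ∀ v ∈ V, h (f v) = v

/-- A finite group `G` acting smoothly and effectively on a connected open set `V` of `ℝ ^ dim`.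
The maps `act g` are written as functions on all of `ℝ ^ dim`; only their values on `V` matter. -/
structure SmoothFiniteAction where
  dim : ℕ
  V : Set (EuclideanSpace ℝ (Fin dim))
  isOpen_V : IsOpen V
  isConnected_V : IsConnected V
  G : Type
  [group : Group G]
  [finite : Finite G]
  act : G → EuclideanSpace ℝ (Fin dim) → EuclideanSpace ℝ (Fin dim)
  act_mem : ∀ g, ∀ v ∈ V, act g v ∈ V
  act_one : ∀ v ∈ V, act 1 v = v
  act_mul : ∀ g h, ∀ v ∈ V, act (g * h) v = act g (act h v)
  act_smooth : ∀ g, ContDiffOn ℝ ∞ (act g) V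
  effective : ∀ g, (∀ v ∈ V, act g v = v) → g = 1

attribute [instance] SmoothFiniteAction.group SmoothFiniteAction.finite

namespace SmoothFiniteAction

/-- The Euclidean space that contains the domain `V` of the action. -/
abbrev Space (A : SmoothFiniteAction) : Type := EuclideanSpace ℝ (Fin A.dim)

theorem act_inv (A : SmoothFiniteAction) {g : A.G} {v w : A.Space} (hv : v ∈ A.V)
    (h : A.act g v = w) : A.act g⁻¹ w = v := by
  rw [← h, ← A.act_mul _ _ _ hv, inv_mul_cancel, A.act_one _ hv]

/-- The relation of lying in the same `G`-orbit; its quotient is the orbit space `V / G`. -/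
def orbitSetoid (A : SmoothFiniteAction) : Setoid A.V where
  r v w := ∃ g, A.act g v = w
  iseqv :=
    { refl := fun v => ⟨1, A.act_one _ v.2⟩
      symm := fun {v _} ⟨g, hg⟩ => ⟨g⁻¹, A.act_inv v.2 hg⟩
      trans := fun {v _ _} ⟨g, hg⟩ ⟨h, hh⟩ => ⟨h * g, by rw [A.act_mul _ _ _ v.2, hg, hh]⟩ }

/-- The stabilizer of a point `v` of `V`. -/
def stabilizer (A : SmoothFiniteAction) (v : A.Space) (hv : v ∈ A.V) : Subgroup A.G where
  carrier := {g | A.act g v = v}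
  one_mem' := A.act_one v hv
  mul_mem' {g h} hg hh := by
    change A.act (g * h) v = v
    rw [A.act_mul _ _ _ hv, show A.act h v = v from hh, show A.act g v = v from hg]
  inv_mem' {g} hg := A.act_inv hv hg

end SmoothFiniteAction

/-- A uniformizing system `(V, G, π)` on `X`: a `G`-invariant map `π : V → X` which induces a
homeomorphism of `V / G` with an open subset of `X`. -/
structure OrbifoldChart (X : Type*) [TopologicalSpace X] extends SmoothFiniteAction where
  π : EuclideanSpace ℝ (Fin dim) → X
  π_act : ∀ g, ∀ v ∈ V, π (act g v) = π v
  isOpenEmbedding_π : Topology.IsOpenEmbedding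
    (Quotient.lift (s := toSmoothFiniteAction.orbitSetoid) (fun v : V => π v)
      (by rintro v w ⟨g, hg⟩; change π v = π w; rw [← hg, π_act g v v.2]))

namespace OrbifoldChart

variable {X : Type*} [TopologicalSpace X]

/-- The open subset of `X` uniformized by the chart. -/
def U (C : OrbifoldChart X) : Set X := C.π '' C.V

/-- An embedding of charts `(V, G, π) ↪ (V', G', π')`. -/
structure Embedding (C D : OrbifoldChart X) where
  toFun : C.Space → D.Space
  mapsTo : Set.MapsTo toFun C.V D.V
  isSmoothOpenEmbeddingOn : IsSmoothOpenEmbeddingOn toFun C.V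
  hom : C.G →* D.G
  hom_injective : Function.Injective hom
  equivariant : ∀ g, ∀ v ∈ C.V, toFun (C.act g v) = D.act (hom g) (toFun v)
  π_toFun : ∀ v ∈ C.V, D.π (toFun v) = C.π v

/-- Two charts are compatible if around every common point there is a smaller chart that embeds
into both. -/
def Compatible (C D : OrbifoldChart X) : Prop :=
  ∀ x ∈ C.U ∩ D.U, ∃ K : OrbifoldChart X, x ∈ K.U ∧ K.U ⊆ C.U ∩ D.U ∧
    Nonempty (Embedding K C) ∧ Nonempty (Embedding K D)

end OrbifoldChart

/-- A (smooth, effective, boundaryless) orbifold structure on `X`, given by an orbifold atlas. -/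
structure OrbifoldStructure (X : Type*) [TopologicalSpace X] where
  atlas : Set (OrbifoldChart X)
  covers : ∀ p : X, ∃ C ∈ atlas, p ∈ C.U
  compatible : ∀ C ∈ atlas, ∀ D ∈ atlas, C.Compatible D

namespace OrbifoldStructure

variable {X : Type*} [TopologicalSpace X]

/-- The uniformizing charts of the orbifold: the charts compatible with its atlas, that is, the
members of the maximal atlas. -/
def charts (O : OrbifoldStructure X) : Set (OrbifoldChart X) :=
  {C | ∀ A ∈ O.atlas, C.Compatible A}

/-- An orbifold `k`-form: a smooth `G`-invariant `k`-form on every uniformizing chart, compatible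
with all embeddings of charts. Only the values of `form C` on `V` matter. -/
structure Form (O : OrbifoldStructure X) (k : ℕ) where
  form : (C : O.charts) → C.1.Space → C.1.Space [⋀^Fin k]→L[ℝ] ℝ
  smooth : ∀ C, ContDiffOn ℝ ∞ (form C) C.1.V
  invariant : ∀ C g, ∀ v ∈ C.1.V,
    (form C (C.1.act g v)).compContinuousLinearMap (fderiv ℝ (C.1.act g) v) = form C v
  compatible : ∀ (C D : O.charts) (e : OrbifoldChart.Embedding C.1 D.1), ∀ v ∈ C.1.V,
    (form D (e.toFun v)).compContinuousLinearMap (fderiv ℝ e.toFun v) = form C v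

/-- An orbifold 2-form is symplectic if it is closed and non-degenerate on every chart. -/
structure Form.IsSymplectic {O : OrbifoldStructure X} (Ω : O.Form 2) : Prop where
  closed : ∀ C : O.charts, ∀ v ∈ C.1.V, extDeriv (Ω.form C) v = 0
  nondegenerate : ∀ C : O.charts, ∀ v ∈ C.1.V, ∀ u : C.1.Space,
    (∀ w, Ω.form C v ![u, w] = 0) → u = 0

end OrbifoldStructure

/-- The value on `(u, w)` of `∑ i, dp i ∧ dq i` at the point `v`, where
`q i = κ (Sum.inl i)` and `p i = κ (Sum.inr i)` are the components of `κ`. -/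
noncomputable def darbouxForm {E : Type*} [NormedAddCommGroup E] [NormedSpace ℝ E] {n : ℕ}
    (κ : E → Fin n ⊕ Fin n → ℝ) (v u w : E) : ℝ :=
  ∑ i : Fin n,
    (fderiv ℝ (fun x => κ x (Sum.inr i)) v u * fderiv ℝ (fun x => κ x (Sum.inl i)) v w -
      fderiv ℝ (fun x => κ x (Sum.inr i)) v w * fderiv ℝ (fun x => κ x (Sum.inl i)) v u)

/-! The problem is local: in the given chart, take the stabilizer `H` of the lift `x`, a finite
group fixing `x`. Averaging over `H` (`exists_linearization`) gives coordinates `ψ` in which `H`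
acts linearly, and the symplectic form becomes an invariant closed form `Ω` near the origin of a
vector space.

Moser's method then straightens `Ω` to its value at the origin. Put `ω_t = Ω + t (Ω 0 - Ω)`, let `σ`
be the radial primitive of `Ω 0 - Ω`, and solve `ι_X ω_t = -σ` for a time-dependent field `X`.
Closedness of `ω_t` makes the pull-back of `ω_t` under the flow constant in `t`, so the time-one map
`θ` satisfies `θ^* (Ω 0) = Ω`. Scaling commutes with linear maps, so `σ`, `X` and `θ` are all
equivariant; this is why linearization comes first. Since `σ` vanishes to second order at the
origin, so does `X`, and the flow lasts until time one near the origin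
(`exists_equivariant_moser_map`). A symplectic basis for `Ω 0` turns the linear action into
symplectic matrices.

The analysis takes place in the Banach space of paths `C([0, 1], E)`. Superposition by a smooth map
is smooth there, which yields both differentiation under the integral sign and, by the inverse
function theorem, a flow that is smooth in its initial point.

Finally the coordinates are restricted to a connected slice at `x`, invariant under `H` and met by
its translates only under `H`. The slice with the group `H` is again a uniformizing chart:
effectiveness survives by `eq_one_of_eventually`, compatibility by `Compatible.restrict`. -/

set_option maxSynthPendingDepth 4

universe u

/-! ### Smoothness of superposition operators on spaces of continuous maps -/

section Superposition

variable {K : Type*} [TopologicalSpace K] [CompactSpace K]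

/-- Pointwise application `(A, η) ↦ (s ↦ A s (η s))`, as a continuous bilinear map. -/
noncomputable def ContinuousMap.applyCLM (K : Type*) [TopologicalSpace K] [CompactSpace K]
    (E F : Type*) [NormedAddCommGroup E] [NormedSpace ℝ E]
    [NormedAddCommGroup F] [NormedSpace ℝ F] :
    C(K, E →L[ℝ] F) →L[ℝ] C(K, E) →L[ℝ] C(K, F) :=
  LinearMap.mkContinuous₂
    (LinearMap.mk₂ ℝ (fun (A : C(K, E →L[ℝ] F)) (η : C(K, E)) =>
        (⟨fun s => A s (η s), by fun_prop⟩ : C(K, F)))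
      (fun _ _ _ => by ext; simp) (fun _ _ _ => by ext; simp)
      (fun _ _ _ => by ext; simp) (fun _ _ _ => by ext; simp)) 1
    (fun A η => by
      rw [one_mul, ContinuousMap.norm_le _ (by positivity)]
      intro s
      exact ((A s).le_opNorm _).trans (mul_le_mul (A.norm_coe_le_norm s) (η.norm_coe_le_norm s)
        (norm_nonneg _) ((norm_nonneg _).trans (A.norm_coe_le_norm s))))

variable {E F : Type*} [NormedAddCommGroup E] [NormedSpace ℝ E]
    [NormedAddCommGroup F] [NormedSpace ℝ F]

@[simp]
theorem ContinuousMap.applyCLM_apply (A : C(K, E →L[ℝ] F)) (η : C(K, E)) (s : K) :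
    ContinuousMap.applyCLM K E F A η s = A s (η s) := rfl

/-- The range of `γ` is compact, so `fderiv ℝ f` is uniformly continuous at its points. The mean
value inequality on balls of one common radius then bounds the remainder by `ε * ‖η‖` uniformly in
the parameter. -/
theorem ContinuousMap.hasFDerivAt_postcomp {f : E → F} (hf : ContDiff ℝ 1 f) (γ : C(K, E)) :
    HasFDerivAt (fun γ : C(K, E) => (⟨f, hf.continuous⟩ : C(E, F)).comp γ)
      (ContinuousMap.applyCLM K E F
        ((⟨fderiv ℝ f, hf.continuous_fderiv one_ne_zero⟩ : C(E, E →L[ℝ] F)).comp γ)) γ := by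
  rw [hasFDerivAt_iff_isLittleO_nhds_zero, Asymptotics.isLittleO_iff]
  intro ε hε
  have hK : IsCompact (Set.range γ) := isCompact_range γ.continuous
  have hu : {x : E × E | x.1 ∈ Set.range γ → (fderiv ℝ f x.1, fderiv ℝ f x.2) ∈
      {p : (E →L[ℝ] F) × (E →L[ℝ] F) | dist p.1 p.2 < ε}} ∈ uniformity E :=
    hK.uniformContinuousAt_of_continuousAt (fderiv ℝ f)
      (fun x _ => (hf.continuous_fderiv one_ne_zero).continuousAt) (Metric.dist_mem_uniformity hε)
  obtain ⟨δ, hδ, hd⟩ := Metric.mem_uniformity_dist.1 hu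
  filter_upwards [Metric.ball_mem_nhds (0 : C(K, E)) hδ] with η hη
  rw [ContinuousMap.norm_le _ (by positivity)]
  intro s
  have hηs : ‖η s‖ < δ := (η.norm_coe_le_norm s).trans_lt (by simpa using hη)
  have key := (convex_ball (γ s) δ).norm_image_sub_le_of_norm_hasFDerivWithin_le' (f := f)
    (f' := fderiv ℝ f) (φ := fderiv ℝ f (γ s)) (C := ε) (x := γ s) (y := γ s + η s)
    (fun z _ => (hf.differentiable one_ne_zero z).hasFDerivAt.hasFDerivWithinAt)
    (fun z hz => by
      have := hd (a := γ s) (b := z) (by rw [dist_comm]; exact hz) ⟨s, rfl⟩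
      rw [← dist_eq_norm, dist_comm]
      exact le_of_lt this)
    (Metric.mem_ball_self hδ) (by simpa [Metric.mem_ball, dist_eq_norm] using hηs)
  refine le_trans ?_ (mul_le_mul_of_nonneg_left (η.norm_coe_le_norm s) hε.le)
  simpa using key

end Superposition

/-- The derivative is superposition by `fderiv ℝ f`, one order less smooth, followed by the linear
`applyCLM`. The induction therefore changes the target to `E →L[ℝ] F`, which is why `F` is
generalized and shares the universe of `E`. -/
theorem ContinuousMap.contDiff_postcomp_nat {K : Type*} [TopologicalSpace K] [CompactSpace K]
    {E : Type u} [NormedAddCommGroup E] [NormedSpace ℝ E] (n : ℕ) :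
    ∀ {F : Type u} [NormedAddCommGroup F] [NormedSpace ℝ F] {f : E → F} (hf : ContDiff ℝ n f),
    ContDiff ℝ n (fun γ : C(K, E) => (⟨f, hf.continuous⟩ : C(E, F)).comp γ) := by
  induction n with
  | zero =>
    intro F _ _ f hf
    exact contDiff_zero.2 (ContinuousMap.continuous_postcomp _)
  | succ n ih =>
    intro F _ _ f hf
    have h1 : ContDiff ℝ 1 f := hf.of_le (by exact_mod_cast Nat.le_add_left 1 n)
    have hd : ContDiff ℝ n (fderiv ℝ f) := hf.fderiv_right (by push_cast; exact le_rfl)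
    have := (ContinuousMap.applyCLM K E F).contDiff.comp (n := n) (ih hd)
    push_cast
    exact (contDiff_succ_iff_hasFDerivAt).2 ⟨_, this, fun γ => ContinuousMap.hasFDerivAt_postcomp h1 γ⟩

theorem ContinuousMap.contDiff_postcomp {K : Type*} [TopologicalSpace K] [CompactSpace K]
    {E F : Type u} [NormedAddCommGroup E] [NormedSpace ℝ E]
    [NormedAddCommGroup F] [NormedSpace ℝ F] {f : E → F} (hf : ContDiff ℝ ∞ f) :
    ContDiff ℝ ∞ (fun γ : C(K, E) => (⟨f, hf.continuous⟩ : C(E, F)).comp γ) :=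
  contDiff_infty.2 fun n => ContinuousMap.contDiff_postcomp_nat n
    (hf.of_le (by exact_mod_cast le_top))

/-! ### Primitives and constant paths as linear operators on path space -/

section Integral

open unitInterval MeasureTheory

variable {F : Type*} [NormedAddCommGroup F] [NormedSpace ℝ F]

/-- The primitive `t ↦ ∫ s in 0..t, γ s`, as a continuous linear operator on `C([0, 1], F)`. -/
noncomputable def primitiveCLM (F : Type*) [NormedAddCommGroup F] [NormedSpace ℝ F] :
    C(I, F) →L[ℝ] C(I, F) :=
  LinearMap.mkContinuous
    { toFun := fun γ => ⟨fun t => ∫ s in (0 : ℝ)..t, γ (Set.projIcc 0 1 zero_le_one s),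
        (intervalIntegral.continuous_primitive
          (fun a b => (γ.continuous.comp continuous_projIcc).intervalIntegrable a b) 0).comp
            continuous_subtype_val⟩
      map_add' := fun γ η => by
        ext t
        exact intervalIntegral.integral_add
          ((γ.continuous.comp continuous_projIcc).intervalIntegrable _ _)
          ((η.continuous.comp continuous_projIcc).intervalIntegrable _ _)
      map_smul' := fun c γ => by
        ext t
        exact intervalIntegral.integral_smul _ _ }
    1
    (fun γ => by
      rw [one_mul, ContinuousMap.norm_le _ (norm_nonneg _)]
      intro t
      refine (intervalIntegral.norm_integral_le_of_norm_le_const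
        (fun s _ => γ.norm_coe_le_norm (Set.projIcc 0 1 zero_le_one s))).trans ?_
      rw [sub_zero, abs_of_nonneg t.2.1]
      exact mul_le_of_le_one_right (norm_nonneg _) t.2.2)

theorem primitiveCLM_apply (γ : C(I, F)) (t : I) :
    primitiveCLM F γ t = ∫ s in (0 : ℝ)..t, γ (Set.projIcc 0 1 zero_le_one s) := rfl

@[simp]
theorem primitiveCLM_apply_zero (γ : C(I, F)) : primitiveCLM F γ 0 = 0 := by
  simp [primitiveCLM_apply]

theorem hasDerivAt_primitive [CompleteSpace F] (γ : C(I, F)) (t : ℝ) :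
    HasDerivAt (fun t => ∫ s in (0 : ℝ)..t, γ (Set.projIcc 0 1 zero_le_one s))
      (γ (Set.projIcc 0 1 zero_le_one t)) t :=
  (γ.continuous.comp continuous_projIcc).integral_hasStrictDerivAt 0 t |>.hasDerivAt

/-- Constant paths, as a continuous linear map. -/
noncomputable def constPathCLM (F : Type*) [NormedAddCommGroup F] [NormedSpace ℝ F] :
    F →L[ℝ] C(I, F) :=
  LinearMap.mkContinuous
    { toFun := fun v => ContinuousMap.const I v
      map_add' := fun _ _ => rfl
      map_smul' := fun _ _ => rfl } 1
    (fun v => by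
      rw [one_mul, ContinuousMap.norm_le _ (norm_nonneg _)]
      exact fun _ => le_rfl)

@[simp]
theorem constPathCLM_apply (v : F) (t : I) : constPathCLM F v t = v := rfl

/-- Pairing with time, `γ ↦ (t ↦ (t, γ t))`. -/
def timePath {F : Type*} [TopologicalSpace F] (γ : C(I, F)) : C(I, ℝ × F) :=
  ⟨fun t => ((t : ℝ), γ t), by fun_prop⟩

@[simp]
theorem timePath_apply {F : Type*} [TopologicalSpace F] (γ : C(I, F)) (t : I) : timePath γ t = ((t : ℝ), γ t) := rfl

/-- The linear part of `timePath`. -/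
noncomputable def inrPathCLM (F : Type*) [NormedAddCommGroup F] [NormedSpace ℝ F] :
    C(I, F) →L[ℝ] C(I, ℝ × F) :=
  (ContinuousLinearMap.inr ℝ ℝ F).compLeftContinuous ℝ I

@[simp]
theorem inrPathCLM_apply (γ : C(I, F)) (t : I) : inrPathCLM F γ t = (0, γ t) := rfl

theorem hasFDerivAt_timePath (γ : C(I, F)) : HasFDerivAt timePath (inrPathCLM F) γ := by
  have : (timePath : C(I, F) → C(I, ℝ × F)) = fun γ => timePath 0 + inrPathCLM F γ := by
    ext γ t <;> simp
  rw [this]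
  exact (inrPathCLM F).hasFDerivAt.const_add _

theorem contDiff_timePath : ContDiff ℝ ∞ (timePath : C(I, F) → C(I, ℝ × F)) := by
  have : (timePath : C(I, F) → C(I, ℝ × F)) = fun γ => timePath 0 + inrPathCLM F γ := by
    ext γ t <;> simp
  rw [this]
  exact contDiff_const.add (inrPathCLM F).contDiff

end Integral

/-! ### Differentiation under the integral sign -/

section ParametricIntegral

open unitInterval MeasureTheory

variable {E F : Type u} [NormedAddCommGroup E] [NormedSpace ℝ E]
    [NormedAddCommGroup F] [NormedSpace ℝ F]

theorem primitiveCLM_apply_one (γ : C(I, F)) {g : ℝ → F} (hg : ∀ t : I, γ t = g t) :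
    primitiveCLM F γ 1 = ∫ t in (0 : ℝ)..1, g t := by
  rw [primitiveCLM_apply]
  refine intervalIntegral.integral_congr fun t ht => ?_
  rw [Set.Icc.coe_one, Set.uIcc_of_le zero_le_one] at ht
  simp only [Set.projIcc_of_mem zero_le_one ht, hg]

/-- Superposition with a time-dependent map. -/
def superposition {f : ℝ × E → F} (hf : ContDiff ℝ ∞ f) (γ : C(I, E)) : C(I, F) :=
  (⟨f, hf.continuous⟩ : C(ℝ × E, F)).comp (timePath γ)

@[simp]
theorem superposition_apply {f : ℝ × E → F} (hf : ContDiff ℝ ∞ f) (γ : C(I, E)) (t : I) :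
    superposition hf γ t = f (t, γ t) := rfl

theorem contDiff_superposition {f : ℝ × E → F} (hf : ContDiff ℝ ∞ f) :
    ContDiff ℝ ∞ (superposition hf) :=
  (ContinuousMap.contDiff_postcomp hf).comp contDiff_timePath

theorem fderiv_superposition_apply {f : ℝ × E → F} (hf : ContDiff ℝ ∞ f) (γ η : C(I, E)) (t : I) :
    fderiv ℝ (superposition hf) γ η t = fderiv ℝ f (t, γ t) (0, η t) := by
  have h1 : ContDiff ℝ 1 f := hf.of_le (by exact_mod_cast le_top)
  have := (ContinuousMap.hasFDerivAt_postcomp h1 (timePath γ)).comp γ (hasFDerivAt_timePath γ)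
  have h2 : HasFDerivAt (superposition hf) _ γ := this
  rw [h2.fderiv]
  simp

/-- Exhibits a parametric integral as a constant path (linear), a superposition (smooth), a
primitive and an evaluation (linear); the chain rule does the rest. -/
theorem integral_eq_primitiveCLM_superposition {f : ℝ × E → F} (hf : ContDiff ℝ ∞ f) :
    (fun x => ∫ t in (0 : ℝ)..1, f (t, x)) =
      fun x => primitiveCLM F (superposition hf (constPathCLM E x)) 1 := by
  ext x
  exact (primitiveCLM_apply_one _ fun t => rfl).symm

theorem contDiff_integral_zero_one {f : ℝ × E → F} (hf : ContDiff ℝ ∞ f) :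
    ContDiff ℝ ∞ fun x => ∫ t in (0 : ℝ)..1, f (t, x) := by
  rw [integral_eq_primitiveCLM_superposition hf]
  exact ((ContinuousMap.evalCLM ℝ (1 : I)).comp (primitiveCLM F)).contDiff.comp
    ((contDiff_superposition hf).comp (constPathCLM E).contDiff)

theorem fderiv_integral_zero_one {f : ℝ × E → F} (hf : ContDiff ℝ ∞ f) (x v : E) :
    fderiv ℝ (fun x => ∫ t in (0 : ℝ)..1, f (t, x)) x v =
      ∫ t in (0 : ℝ)..1, fderiv ℝ f (t, x) (0, v) := by
  rw [integral_eq_primitiveCLM_superposition hf]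
  have h := (((contDiff_superposition hf).differentiable (by simp)
    (constPathCLM E x)).hasFDerivAt.comp x (constPathCLM E).hasFDerivAt)
  have h2 := ((ContinuousMap.evalCLM ℝ (1 : I)).comp (primitiveCLM F)).hasFDerivAt.comp x h
  have h3 : HasFDerivAt (fun x => primitiveCLM F (superposition hf (constPathCLM E x)) 1) _ x := h2
  rw [h3.fderiv]
  refine primitiveCLM_apply_one _ fun t => ?_
  simp [fderiv_superposition_apply]

end ParametricIntegral

/-! ### Radial primitives and the Poincaré lemma for 2-forms -/

section Poincare

variable {E : Type u} [NormedAddCommGroup E] [NormedSpace ℝ E]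

theorem hasFDerivAt_bilin_apply {δ : E → E →L[ℝ] E →L[ℝ] ℝ} {y : E}
    (h : DifferentiableAt ℝ δ y) (a b : E) :
    HasFDerivAt (fun y => δ y a b) (((ContinuousLinearMap.apply ℝ ℝ b).comp
        (ContinuousLinearMap.apply ℝ (E →L[ℝ] ℝ) a)).comp (fderiv ℝ δ y)) y :=
  HasFDerivAt.comp (g := fun A : E →L[ℝ] E →L[ℝ] ℝ => A a b) y
    ((ContinuousLinearMap.apply ℝ ℝ b).comp
        (ContinuousLinearMap.apply ℝ (E →L[ℝ] ℝ) a)).hasFDerivAt h.hasFDerivAt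

/-- The derivative of a family of alternating forms is alternating. -/
theorem fderiv_alternating {δ : E → E →L[ℝ] E →L[ℝ] ℝ} {y : E} (h : DifferentiableAt ℝ δ y)
    (halt : ∀ᶠ z in nhds y, ∀ v w, δ z v w = -δ z w v) (u a b : E) :
    fderiv ℝ δ y u a b = -fderiv ℝ δ y u b a := by
  have h1 := hasFDerivAt_bilin_apply h a b
  have h2 := (hasFDerivAt_bilin_apply h b a).neg.congr_of_eventuallyEq
    (f₁ := fun y => δ y a b) (halt.mono fun z hz => hz a b)
  simpa using congrArg (fun A => A u) (h1.unique h2)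

/-- The integrand of the radial primitive of the 2-form `δ`. -/
noncomputable def radialIntegrand (δ : E → E →L[ℝ] E →L[ℝ] ℝ) (p : ℝ × E) : E →L[ℝ] ℝ :=
  p.1 • δ (p.1 • p.2) p.2

/-- The radial primitive `x ↦ ∫ t in 0..1, t • ι_x δ (t • x)` of the 2-form `δ`. -/
noncomputable def radialPrimitive (δ : E → E →L[ℝ] E →L[ℝ] ℝ) (x : E) : E →L[ℝ] ℝ :=
  ∫ t in (0 : ℝ)..1, radialIntegrand δ (t, x)

variable {δ : E → E →L[ℝ] E →L[ℝ] ℝ}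

theorem contDiff_radialIntegrand (hδ : ContDiff ℝ ∞ δ) : ContDiff ℝ ∞ (radialIntegrand δ) :=
  contDiff_fst.smul ((hδ.comp (contDiff_fst.smul contDiff_snd)).clm_apply contDiff_snd)

theorem contDiff_radialPrimitive (hδ : ContDiff ℝ ∞ δ) : ContDiff ℝ ∞ (radialPrimitive δ) :=
  contDiff_integral_zero_one (contDiff_radialIntegrand hδ)

theorem fderiv_radialIntegrand (hδ : ContDiff ℝ ∞ δ) (t : ℝ) (x v : E) :
    fderiv ℝ (radialIntegrand δ) (t, x) (0, v) =
      t • (δ (t • x) v + t • fderiv ℝ δ (t • x) v x) := by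
  have hd := (hδ.differentiable (by simp) (t • x)).hasFDerivAt
  have h1 : HasFDerivAt (fun y : E => (t, y)) (ContinuousLinearMap.inr ℝ ℝ E) x :=
    hasFDerivAt_prodMk_right t x
  have h2 := ((contDiff_radialIntegrand hδ).differentiable (by simp) (t, x)).hasFDerivAt.comp x h1
  have h3 : HasFDerivAt (fun y : E => t • δ (t • y) y) _ x :=
    ((hd.comp x ((hasFDerivAt_id x).const_smul t)).clm_apply (hasFDerivAt_id x)).const_smul t
  have h4 := congrArg (fun A => A v) (h2.unique h3)
  simp only [ContinuousLinearMap.comp_apply, ContinuousLinearMap.inr_apply] at h4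
  rw [h4]
  simp

theorem fderiv_radialPrimitive (hδ : ContDiff ℝ ∞ δ) (x v : E) :
    fderiv ℝ (radialPrimitive δ) x v =
      ∫ t in (0 : ℝ)..1, t • (δ (t • x) v + t • fderiv ℝ δ (t • x) v x) :=
  (fderiv_integral_zero_one (contDiff_radialIntegrand hδ) x v).trans
    (intervalIntegral.integral_congr fun t _ => fderiv_radialIntegrand hδ t x v)

theorem radialPrimitive_apply (hδ : ContDiff ℝ ∞ δ) (x v : E) :
    radialPrimitive δ x v = ∫ t in (0 : ℝ)..1, t * δ (t • x) x v := by
  have hc : Continuous fun t : ℝ => radialIntegrand δ (t, x) :=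
    (contDiff_radialIntegrand hδ).continuous.comp (by fun_prop)
  exact (ContinuousLinearMap.intervalIntegral_apply (hc.intervalIntegrable 0 1) v)

theorem fderiv_radialPrimitive_apply (hδ : ContDiff ℝ ∞ δ) (x v w : E) :
    fderiv ℝ (radialPrimitive δ) x v w =
      ∫ t in (0 : ℝ)..1, t * (δ (t • x) v w + t * fderiv ℝ δ (t • x) v x w) := by
  rw [fderiv_radialPrimitive hδ]
  have hc := hδ.continuous
  have hc' : Continuous (fderiv ℝ δ) := hδ.continuous_fderiv (by simp)
  have : Continuous fun t : ℝ => t • (δ (t • x) v + t • fderiv ℝ δ (t • x) v x) := by fun_prop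
  exact (ContinuousLinearMap.intervalIntegral_apply (this.intervalIntegrable 0 1) w)

theorem radialPrimitive_zero : radialPrimitive δ 0 = 0 := by
  simp [radialPrimitive, radialIntegrand]

/-- With `radialPrimitive_zero`, this is the second-order vanishing that keeps the Moser flow near
the origin alive up to time one. -/
theorem fderiv_radialPrimitive_zero (hδ : ContDiff ℝ ∞ δ) (h0 : δ 0 = 0) :
    fderiv ℝ (radialPrimitive δ) 0 = 0 := by
  ext v w
  rw [fderiv_radialPrimitive_apply hδ]
  simp [h0]

/-- Linear maps commute with the scaling homotopy, so an invariant form has an invariant primitive.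
Star-convexity keeps the whole segment from the origin in the set of invariance. -/
theorem radialPrimitive_map (hδ : ContDiff ℝ ∞ δ) {s : Set E} (hs : StarConvex ℝ 0 s)
    (L : E →L[ℝ] E) (hL : ∀ x ∈ s, ∀ v w, δ (L x) (L v) (L w) = δ x v w) {x : E} (hx : x ∈ s)
    (v : E) : radialPrimitive δ (L x) (L v) = radialPrimitive δ x v := by
  rw [radialPrimitive_apply hδ, radialPrimitive_apply hδ]
  refine intervalIntegral.integral_congr fun t ht => ?_
  rw [Set.uIcc_of_le zero_le_one] at ht
  rw [← map_smul, hL _ (hs.smul_mem hx ht.1 ht.2)]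

/-- The Poincaré lemma for closed 2-forms on a star-shaped set. -/
theorem fderiv_radialPrimitive_sub (hδ : ContDiff ℝ ∞ δ) {s : Set E} (hso : IsOpen s)
    (hs : StarConvex ℝ 0 s) (halt : ∀ x ∈ s, ∀ v w, δ x v w = -δ x w v)
    (hcl : ∀ x ∈ s, ∀ u v w,
      fderiv ℝ δ x u v w + fderiv ℝ δ x v w u + fderiv ℝ δ x w u v = 0)
    {x : E} (hx : x ∈ s) (v w : E) :
    fderiv ℝ (radialPrimitive δ) x v w - fderiv ℝ (radialPrimitive δ) x w v = δ x v w := by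
  have hc := hδ.continuous
  have hc' : Continuous (fderiv ℝ δ) := hδ.continuous_fderiv (by simp)
  have happ := fun y => hasFDerivAt_bilin_apply (hδ.differentiable (by simp) y)
  rw [fderiv_radialPrimitive_apply hδ, fderiv_radialPrimitive_apply hδ,
    ← intervalIntegral.integral_sub (Continuous.intervalIntegrable (by fun_prop) _ _)
      (Continuous.intervalIntegrable (by fun_prop) _ _)]
  -- Closedness turns the integrand of `dσ` into the derivative of `t ^ 2 * δ (t • x) v w`, whose
  -- increment over `[0, 1]` is `δ x v w`.
  have hderiv : ∀ t : ℝ, HasDerivAt (fun t : ℝ => t ^ 2 * δ (t • x) v w)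
      (2 * t * δ (t • x) v w + t ^ 2 * fderiv ℝ δ (t • x) x v w) t := by
    intro t
    have h1 : HasDerivAt (fun t : ℝ => t • x) x t := by
      simpa using (hasDerivAt_id t).smul_const x
    have h2 := (happ (t • x) v w).comp_hasDerivAt t h1
    have h3 := (hasDerivAt_pow 2 t).mul h2
    convert! h3 using 1
    simp
  have hint := intervalIntegral.integral_eq_sub_of_hasDerivAt (a := 0) (b := 1)
    (fun t _ => hderiv t) (Continuous.intervalIntegrable (by fun_prop) _ _)
  have hval : ∫ t in (0 : ℝ)..1, (2 * t * δ (t • x) v w + t ^ 2 * fderiv ℝ δ (t • x) x v w)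
      = δ x v w := by
    rw [hint]; simp
  rw [← hval]
  refine intervalIntegral.integral_congr fun t ht => ?_
  rw [Set.uIcc_of_le zero_le_one] at ht
  have h1 := hcl _ (hs.smul_mem hx ht.1 ht.2) x v w
  have hm := hs.smul_mem hx ht.1 ht.2
  have h2 := halt (t • x) hm w v
  have h3 := fderiv_alternating (hδ.differentiable (by simp) _)
    (Filter.eventually_of_mem (hso.mem_nhds hm) halt) v w x
  rw [h2]
  linear_combination t ^ 2 * h3 - t ^ 2 * h1

end Poincare

/-! ### Inverse function theorem with a smooth inverse on an open set -/

section InverseFunction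

variable {E F : Type*} [NormedAddCommGroup E] [NormedSpace ℝ E] [CompleteSpace E]
  [NormedAddCommGroup F] [NormedSpace ℝ F]

/-- The inverse function theorem for maps that are smooth on an open set, with an inverse that is
smooth on an open set. -/
theorem ContDiffOn.exists_openPartialHomeomorph {f : E → F} {U : Set E} (hU : IsOpen U)
    (hf : ContDiffOn ℝ ∞ f U) {a : E} (ha : a ∈ U) {f' : E ≃L[ℝ] F}
    (hf' : HasFDerivAt f (f' : E →L[ℝ] F) a) :
    ∃ e : OpenPartialHomeomorph E F, a ∈ e.source ∧ e.source ⊆ U ∧ ⇑e = f ∧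
      ContDiffOn ℝ ∞ e.symm e.target ∧
      ∀ x ∈ e.source, ∃ A : E ≃L[ℝ] F, HasFDerivAt f (A : E →L[ℝ] F) x := by
  have hn : (∞ : WithTop ℕ∞) ≠ 0 := by simp
  have hfa : ∀ x ∈ U, ContDiffAt ℝ ∞ f x := fun x hx => hf.contDiffAt (hU.mem_nhds hx)
  have hd : ContinuousOn (fderiv ℝ f) U := fun x hx =>
    ((hfa x hx).continuousAt_fderiv hn).continuousWithinAt
  -- The derivative is invertible on an open set; restricting to it makes the inverse smooth on the
  -- whole target and not only at `f a`.
  set S : Set E := U ∩ fderiv ℝ f ⁻¹' Set.range ((↑) : (E ≃L[ℝ] F) → E →L[ℝ] F) with hSdef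
  have hS : IsOpen S := hd.isOpen_inter_preimage hU ContinuousLinearEquiv.isOpen
  set e₀ := (hfa a ha).toOpenPartialHomeomorph f hf' hn
  have hA : ∀ x ∈ S, ∃ A : E ≃L[ℝ] F, HasFDerivAt f (A : E →L[ℝ] F) x := by
    rintro x ⟨hx, A, hA⟩
    exact ⟨A, hA ▸ ((hfa x hx).differentiableAt hn).hasFDerivAt⟩
  have hcoe : ⇑e₀ = f := rfl
  refine ⟨e₀.restrOpen S hS, ?_, ?_, hcoe, ?_, ?_⟩
  · rw [OpenPartialHomeomorph.restrOpen_source]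
    exact ⟨(hfa a ha).mem_toOpenPartialHomeomorph_source hf' hn, ha, f', hf'.fderiv.symm⟩
  · rw [OpenPartialHomeomorph.restrOpen_source]
    exact fun x hx => hx.2.1
  · intro y hy
    have hy' := (e₀.restrOpen S hS).map_target hy
    have hyS : (e₀.restrOpen S hS).symm y ∈ S := by
      rw [OpenPartialHomeomorph.restrOpen_source] at hy'
      exact hy'.2
    obtain ⟨A, hA⟩ := hA _ hyS
    exact ((e₀.restrOpen S hS).contDiffAt_symm hy hA (hfa _ hyS.1)).contDiffWithinAt
  · intro x hx
    rw [OpenPartialHomeomorph.restrOpen_source] at hx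
    exact hA x hx.2

end InverseFunction

/-! ### Flows by the inverse function theorem in path space -/

section Flow

open unitInterval MeasureTheory Filter Topology

variable {E : Type u} [NormedAddCommGroup E] [NormedSpace ℝ E] [CompleteSpace E]

/-- Smooth dependence on initial conditions: near a point at which a time-dependent smooth
vector field vanishes to second order, the time-one flow exists as a smooth map into the space of
paths. -/
theorem exists_contDiffOn_flow {f : ℝ × E → E} (hf : ContDiff ℝ ∞ f)
    (h0 : ∀ t : I, f (t, 0) = 0) (h0' : ∀ (t : I) (v : E), fderiv ℝ f (t, 0) (0, v) = 0) :
    ∃ (Γ : E → C(I, E)) (U : Set E), IsOpen U ∧ 0 ∈ U ∧ ContDiffOn ℝ ∞ Γ U ∧ Γ 0 = 0 ∧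
      (∀ x ∈ U, Γ x = constPathCLM E x + primitiveCLM E (superposition hf (Γ x))) ∧
      (∀ᶠ p in 𝓝 ((0 : E), (0 : C(I, E))),
        p.2 = constPathCLM E p.1 + primitiveCLM E (superposition hf p.2) → p.2 = Γ p.1) := by
  have hN := contDiff_superposition hf
  have hN0 : superposition hf 0 = 0 := by ext t; simp [h0]
  have hN0' : fderiv ℝ (superposition hf) 0 = 0 := by
    ext η t
    simp [fderiv_superposition_apply, h0']
  -- `Φ (x, γ) = (x, 0)` says that `γ` is the integral curve starting at `x`. Superposition has zero
  -- derivative at the zero path, so `Φ` linearizes to `(x, η) ↦ (x, η - x)`, with explicit inverse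
  -- `(x, η) ↦ (x, η + x)`.
  set Φ : E × C(I, E) → E × C(I, E) := fun p =>
    (p.1, p.2 - (constPathCLM E p.1 + primitiveCLM E (superposition hf p.2))) with hΦ
  have hΦs : ContDiff ℝ ∞ Φ :=
    contDiff_fst.prodMk (contDiff_snd.sub (((constPathCLM E).contDiff.comp contDiff_fst).add
      ((primitiveCLM E).contDiff.comp (hN.comp contDiff_snd))))
  let Φ' : (E × C(I, E)) ≃L[ℝ] (E × C(I, E)) := ContinuousLinearEquiv.equivOfInverse
    ((ContinuousLinearMap.fst ℝ E C(I, E)).prod (ContinuousLinearMap.snd ℝ E C(I, E) -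
      (constPathCLM E).comp (ContinuousLinearMap.fst ℝ E C(I, E))))
    ((ContinuousLinearMap.fst ℝ E C(I, E)).prod (ContinuousLinearMap.snd ℝ E C(I, E) +
      (constPathCLM E).comp (ContinuousLinearMap.fst ℝ E C(I, E))))
    (fun p => by ext <;> simp) (fun p => by ext <;> simp)
  have hΦ' : HasFDerivAt Φ (Φ' : (E × C(I, E)) →L[ℝ] (E × C(I, E))) 0 := by
    have h1 : HasFDerivAt (superposition hf ∘ Prod.snd)
        ((fderiv ℝ (superposition hf) 0).comp (ContinuousLinearMap.snd ℝ E C(I, E))) 0 :=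
      HasFDerivAt.comp (g := superposition hf) (0 : E × C(I, E))
        (hN.differentiable (by simp) 0).hasFDerivAt hasFDerivAt_snd
    have h2 := (hasFDerivAt_fst (𝕜 := ℝ) (p := (0 : E × C(I, E)))).prodMk
      ((hasFDerivAt_snd (𝕜 := ℝ) (p := (0 : E × C(I, E)))).sub
      (((constPathCLM E).hasFDerivAt.comp (0 : E × C(I, E)) hasFDerivAt_fst).add
        ((primitiveCLM E).hasFDerivAt.comp (0 : E × C(I, E)) h1)))
    convert! h2 using 1
    rw [hN0']
    ext p <;> simp [Φ']
  have hΦ0 : Φ 0 = 0 := by simp [hΦ, hN0]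
  obtain ⟨e, he0, -, hcoe, hsymm, -⟩ :=
    hΦs.contDiffOn.exists_openPartialHomeomorph isOpen_univ (Set.mem_univ 0) hΦ'
  have ht0 : (0 : E × C(I, E)) ∈ e.target := by
    have := e.map_source he0
    rwa [hcoe, hΦ0] at this
  have hι : ContDiff ℝ ∞ fun x : E => (x, (0 : C(I, E))) := contDiff_id.prodMk contDiff_const
  have hU : IsOpen ((fun x : E => (x, (0 : C(I, E)))) ⁻¹' e.target) :=
    e.open_target.preimage hι.continuous
  refine ⟨fun x => (e.symm (x, 0)).2, _, hU, ht0, ?_, ?_, ?_, ?_⟩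
  · exact contDiff_snd.comp_contDiffOn (hsymm.comp hι.contDiffOn (fun x hx => hx))
  · have := e.left_inv he0
    rw [hcoe, hΦ0] at this
    exact congrArg Prod.snd this
  · intro x hx
    have hx := e.right_inv hx
    rw [hcoe] at hx
    have h1 : (e.symm (x, 0)).1 = x := congrArg Prod.fst hx
    have h2 := congrArg Prod.snd hx
    simp only [hΦ, h1] at h2
    exact sub_eq_zero.1 h2
  -- Uniqueness of integral curves close to the zero path is injectivity of the local homeomorphism.
  · filter_upwards [e.open_source.mem_nhds he0] with p hp h
    have : Φ p = (p.1, 0) := Prod.ext rfl (sub_eq_zero.2 h)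
    have hp := e.left_inv hp
    rw [hcoe, this] at hp
    exact (congrArg Prod.snd hp).symm

variable {f : ℝ × E → E} {hf : ContDiff ℝ ∞ f} {γ : C(I, E)} {x : E}

omit [CompleteSpace E] in
theorem apply_zero_of_eq_primitive {β : C(I, E)} (h : γ = constPathCLM E x + primitiveCLM E β) :
    γ 0 = x := by
  rw [h]; simp

/-- A path that is the primitive of a path `β` is differentiable, with derivative `β`. -/
theorem hasDerivWithinAt_of_eq_primitive {β : C(I, E)}
    (h : γ = constPathCLM E x + primitiveCLM E β) {t : ℝ} (ht : t ∈ I) :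
    HasDerivWithinAt (fun s => γ (Set.projIcc 0 1 zero_le_one s)) (β ⟨t, ht⟩) I t := by
  have h1 := ((hasDerivAt_primitive β t).const_add x).hasDerivWithinAt (s := I)
  rw [Set.projIcc_of_mem zero_le_one ht] at h1
  refine h1.congr_of_mem (fun s hs => ?_) ht
  rw [Set.projIcc_of_mem zero_le_one hs, h]
  simp [primitiveCLM_apply]

omit [CompleteSpace E] in
/-- The variational equation. -/
theorem fderiv_flow_eq {Γ : E → C(I, E)} (hΓ : DifferentiableAt ℝ Γ x)
    (h : ∀ᶠ y in 𝓝 x, Γ y = constPathCLM E y + primitiveCLM E (superposition hf (Γ y))) (v : E) :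
    fderiv ℝ Γ x v = constPathCLM E v +
      primitiveCLM E (fderiv ℝ (superposition hf) (Γ x) (fderiv ℝ Γ x v)) := by
  have h1 := (constPathCLM E).hasFDerivAt.add ((primitiveCLM E).hasFDerivAt.comp x
    ((((contDiff_superposition hf).differentiable (by simp)) (Γ x)).hasFDerivAt.comp x
      hΓ.hasFDerivAt))
  have h2 : HasFDerivAt Γ _ x := h1.congr_of_eventuallyEq h
  conv_lhs => rw [h2.fderiv]
  simp

end Flow

/-! ### Extension of germs to globally smooth maps -/

section Cutoff

open Filter Topology
open scoped Manifold

/-- A map that is smooth on a neighbourhood of a closed set agrees near that set with a map that is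
smooth everywhere. -/
theorem ContDiffOn.exists_contDiff_eventuallyEq {E F : Type*} [NormedAddCommGroup E]
    [NormedSpace ℝ E] [FiniteDimensional ℝ E] [NormedAddCommGroup F] [NormedSpace ℝ F]
    {f : E → F} {U K : Set E} (hf : ContDiffOn ℝ ∞ f U) (hU : IsOpen U) (hK : IsClosed K)
    (hKU : K ⊆ U) : ∃ g : E → F, ContDiff ℝ ∞ g ∧ g =ᶠ[𝓝ˢ K] f := by
  have : ProperSpace E := FiniteDimensional.proper ℝ E
  obtain ⟨χ, h0, h1, -⟩ := exists_contMDiffMap_zero_one_nhds_of_isClosed (n := ⊤) 𝓘(ℝ, E)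
    hU.isClosed_compl hK (Set.disjoint_compl_left_iff_subset.2 hKU)
  have hχ : ContDiff ℝ ∞ χ := χ.contMDiff.contDiff
  refine ⟨fun x => χ x • f x, contDiff_iff_contDiffAt.2 fun x => ?_, ?_⟩
  · by_cases hx : x ∈ U
    · exact hχ.contDiffAt.smul (hf.contDiffAt (hU.mem_nhds hx))
    · have : (fun x => χ x • f x) =ᶠ[𝓝 x] fun _ => 0 := by
        filter_upwards [h0.filter_mono (nhds_le_nhdsSet hx)] with y hy
        rw [hy, zero_smul]
      exact contDiffAt_const.congr_of_eventuallyEq this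
  · filter_upwards [h1] with x hx
    rw [hx, one_smul]

end Cutoff

/-! ### The equivariant Moser argument -/

section Moser

open Filter Topology unitInterval

variable {E : Type u} [NormedAddCommGroup E] [NormedSpace ℝ E]

/-- The linear path of 2-forms from `Ω` to the constant form `Ω 0`. -/
noncomputable def moserForm (Ω : E → E →L[ℝ] E →L[ℝ] ℝ) (t : ℝ) (y : E) : E →L[ℝ] E →L[ℝ] ℝ :=
  Ω y + t • (Ω 0 - Ω y)

/-- The radial primitive of `Ω 0 - Ω`. -/
noncomputable def moserPrimitive (Ω : E → E →L[ℝ] E →L[ℝ] ℝ) : E → E →L[ℝ] ℝ :=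
  radialPrimitive fun y => Ω 0 - Ω y

variable {Ω : E → E →L[ℝ] E →L[ℝ] ℝ}

theorem moserForm_zero_left (y : E) : moserForm Ω 0 y = Ω y := by simp [moserForm]

theorem moserForm_one_left (y : E) : moserForm Ω 1 y = Ω 0 := by simp [moserForm]

theorem moserForm_zero_right (t : ℝ) : moserForm Ω t 0 = Ω 0 := by simp [moserForm]

theorem hasFDerivAt_moserForm {y : E} (h : DifferentiableAt ℝ Ω y) (t : ℝ) :
    HasFDerivAt (moserForm Ω t) ((1 - t) • fderiv ℝ Ω y) y := by
  have := h.hasFDerivAt.add ((h.hasFDerivAt.const_sub (Ω 0)).const_smul t)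
  convert! this using 1
  rw [sub_smul, one_smul, smul_neg, sub_eq_add_neg]

/-- Existence of the Moser vector field, cut off to be globally smooth. -/
theorem exists_moser_vectorField [FiniteDimensional ℝ E] (hΩ : ContDiff ℝ ∞ Ω)
    (hinv : (Ω 0).IsInvertible) :
    ∃ (g : ℝ × E → E) (r : ℝ), ContDiff ℝ ∞ g ∧ 0 < r ∧
      ∀ t ∈ I, ∀ y ∈ Metric.ball (0 : E) r,
        Function.Injective (moserForm Ω t y) ∧
        moserForm Ω t y (g (t, y)) = -moserPrimitive Ω y := by
  have : CompleteSpace E := FiniteDimensional.complete ℝ E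
  have hmf : ContDiff ℝ ∞ fun p : ℝ × E => moserForm Ω p.1 p.2 :=
    (hΩ.comp contDiff_snd).add (contDiff_fst.smul (contDiff_const.sub (hΩ.comp contDiff_snd)))
  -- `W` is the open set where `ω_t` is invertible; it contains `I × {0}`, because `ω_t` equals `Ω
  -- 0` at the origin for every `t`.
  set W : Set (ℝ × E) := (fun p : ℝ × E => moserForm Ω p.1 p.2) ⁻¹'
    Set.range ((↑) : (E ≃L[ℝ] (E →L[ℝ] ℝ)) → E →L[ℝ] E →L[ℝ] ℝ)
  have hW : IsOpen W := ContinuousLinearEquiv.isOpen.preimage hmf.continuous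
  have hδ : ContDiff ℝ ∞ fun y => Ω 0 - Ω y := contDiff_const.sub hΩ
  set f : ℝ × E → E := fun p =>
    -(ContinuousLinearMap.inverse (moserForm Ω p.1 p.2) (moserPrimitive Ω p.2))
  have hf : ContDiffOn ℝ ∞ f W := by
    rintro p ⟨A, hA⟩
    have hi : (moserForm Ω p.1 p.2).IsInvertible := ⟨A, hA⟩
    have h1 : ContDiffAt ℝ ∞ (fun p : ℝ × E =>
        ContinuousLinearMap.inverse (moserForm Ω p.1 p.2)) p :=
      ContDiffAt.comp (g := ContinuousLinearMap.inverse) p hi.contDiffAt_map_inverse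
        hmf.contDiffAt
    exact (h1.clm_apply
      ((contDiff_radialPrimitive hδ).comp contDiff_snd).contDiffAt).neg.contDiffWithinAt
  have hK : IsCompact (I ×ˢ ({0} : Set E)) := isCompact_Icc.prod isCompact_singleton
  have hKW : I ×ˢ ({0} : Set E) ⊆ W := by
    rintro ⟨t, y⟩ ⟨-, rfl : y = 0⟩
    simp only [W, Set.mem_preimage, moserForm_zero_right]
    exact hinv
  -- Superposition needs a globally smooth field, hence the cutoff; the tube lemma then gives one
  -- radius valid for all times in `I`.
  obtain ⟨g, hg, hgf⟩ := hf.exists_contDiff_eventuallyEq hW hK.isClosed hKW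
  obtain ⟨V, hV, hKV, hVg⟩ := mem_nhdsSet_iff_exists.1
    (Filter.inter_mem hgf (hW.mem_nhdsSet.2 hKW))
  obtain ⟨A, B, -, hB, hIA, h0B, hAB⟩ :=
    generalized_tube_lemma isCompact_Icc isCompact_singleton hV hKV
  obtain ⟨r, hr, hrB⟩ := Metric.isOpen_iff.1 hB 0 (h0B rfl)
  refine ⟨g, r, hg, hr, fun t ht y hy => ?_⟩
  have hm := hVg (hAB (Set.mk_mem_prod (hIA ht) (hrB hy)))
  obtain ⟨T, hT⟩ := hm.2
  have h1 : g (t, y) = f (t, y) := hm.1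
  refine ⟨?_, ?_⟩
  · change (T : E →L[ℝ] E →L[ℝ] ℝ) = moserForm Ω t y at hT
    rw [← hT]
    exact T.injective
  · change (T : E →L[ℝ] E →L[ℝ] ℝ) = moserForm Ω t y at hT
    simp only [h1, f, ← hT, ContinuousLinearMap.inverse_equiv, map_neg]
    simp

/-- The equation defining the Moser vector field, differentiated along `u`. -/
theorem moser_vectorField_deriv {g : ℝ × E → E} (hΩ : ContDiff ℝ ∞ Ω) (hg : ContDiff ℝ ∞ g)
    {t : ℝ} {y : E} (h : ∀ᶠ z in 𝓝 y, moserForm Ω t z (g (t, z)) = -moserPrimitive Ω z)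
    (u w : E) :
    (1 - t) * fderiv ℝ Ω y u (g (t, y)) w + moserForm Ω t y (fderiv ℝ g (t, y) (0, u)) w =
      -fderiv ℝ (moserPrimitive Ω) y u w := by
  have hδ : ContDiff ℝ ∞ fun y => Ω 0 - Ω y := contDiff_const.sub hΩ
  have hgd : HasFDerivAt (fun z : E => g (t, z))
      ((fderiv ℝ g (t, y)).comp (ContinuousLinearMap.inr ℝ ℝ E)) y :=
    HasFDerivAt.comp (g := g) y (hg.differentiable (by simp) (t, y)).hasFDerivAt
      (hasFDerivAt_prodMk_right t y)
  have h1 := (hasFDerivAt_moserForm (hΩ.differentiable (by simp) y) t).clm_apply hgd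
  have h2 : HasFDerivAt (fun z => -moserPrimitive Ω z) _ y :=
    ((contDiff_radialPrimitive hδ).differentiable (by simp) y).hasFDerivAt.neg
  have h3 := congrArg (fun A => A u w) (h1.unique (h2.congr_of_eventuallyEq h))
  simpa [add_comm, moserPrimitive] using h3

theorem moserPrimitive_deriv_sub {r : ℝ} (hΩ : ContDiff ℝ ∞ Ω)
    (halt : ∀ y ∈ Metric.ball (0 : E) r, ∀ v w, Ω y v w = -Ω y w v)
    (hcl : ∀ y ∈ Metric.ball (0 : E) r, ∀ u v w,
      fderiv ℝ Ω y u v w + fderiv ℝ Ω y v w u + fderiv ℝ Ω y w u v = 0)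
    {y : E} (hy : y ∈ Metric.ball (0 : E) r) (v w : E) :
    fderiv ℝ (moserPrimitive Ω) y v w - fderiv ℝ (moserPrimitive Ω) y w v = Ω 0 v w - Ω y v w := by
  have hδ : ContDiff ℝ ∞ fun y => Ω 0 - Ω y := contDiff_const.sub hΩ
  have h0 : (0 : E) ∈ Metric.ball (0 : E) r :=
    Metric.mem_ball_self (dist_nonneg.trans_lt (Metric.mem_ball.1 hy))
  have := fderiv_radialPrimitive_sub hδ Metric.isOpen_ball
    ((convex_ball (0 : E) r).starConvex h0) (fun x hx v w => by
      simp only [sub_apply]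
      rw [halt x hx, halt 0 h0]; ring) (fun x hx u v w => by
      have hd : fderiv ℝ (fun y => Ω 0 - Ω y) x = -fderiv ℝ Ω x :=
        ((hΩ.differentiable (by simp) x).hasFDerivAt.const_sub (Ω 0)).fderiv
      simp only [hd, neg_apply]
      linear_combination -hcl x hx u v w) hy v w
  simpa [moserPrimitive] using this

/-- Along a solution of the Moser equation, the pairing of two solutions of the variational
equation is constant. -/
theorem moser_pairing_constant {g : ℝ × E → E} {r : ℝ} (hΩ : ContDiff ℝ ∞ Ω)
    (hg : ContDiff ℝ ∞ g)
    (halt : ∀ y ∈ Metric.ball (0 : E) r, ∀ v w, Ω y v w = -Ω y w v)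
    (hcl : ∀ y ∈ Metric.ball (0 : E) r, ∀ u v w,
      fderiv ℝ Ω y u v w + fderiv ℝ Ω y v w u + fderiv ℝ Ω y w u v = 0)
    (hX : ∀ t ∈ I, ∀ y ∈ Metric.ball (0 : E) r,
      moserForm Ω t y (g (t, y)) = -moserPrimitive Ω y)
    {c Y Z : ℝ → E} (hc : ∀ t ∈ I, c t ∈ Metric.ball (0 : E) r)
    (hc' : ∀ t ∈ I, HasDerivWithinAt c (g (t, c t)) I t)
    (hY' : ∀ t ∈ I, HasDerivWithinAt Y (fderiv ℝ g (t, c t) (0, Y t)) I t)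
    (hZ' : ∀ t ∈ I, HasDerivWithinAt Z (fderiv ℝ g (t, c t) (0, Z t)) I t) :
    Ω 0 (Y 1) (Z 1) = Ω (c 0) (Y 0) (Z 0) := by
  have hd : ∀ t ∈ I, HasDerivWithinAt (fun t => moserForm Ω t (c t) (Y t) (Z t)) 0 I t := by
    intro t ht
    have hball := hc t ht
    have hy := hΩ.differentiable (by simp) (c t)
    have h1 : HasDerivWithinAt (fun t => Ω (c t)) (fderiv ℝ Ω (c t) (g (t, c t))) I t :=
      hy.hasFDerivAt.comp_hasDerivWithinAt t (hc' t ht)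
    have h2 : HasDerivWithinAt (fun t => moserForm Ω t (c t)) _ I t :=
      h1.add ((hasDerivWithinAt_id t I).smul (h1.const_sub (Ω 0)))
    have h3 := (h2.clm_apply (hY' t ht)).clm_apply (hZ' t ht)
    convert! h3 using 1
    -- Cartan's formula by hand: `e1` and `e2` antisymmetrize to `d (ι_X ω_t) = -dσ`, `e3`
    -- identifies `dσ` with the time derivative `Ω 0 - Ω`, and `e4`, `e5` express closedness of `Ω`.
    have e1 := moser_vectorField_deriv hΩ hg
      (Filter.eventually_of_mem (Metric.isOpen_ball.mem_nhds hball) (hX t ht)) (Y t) (Z t)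
    have e2 := moser_vectorField_deriv hΩ hg
      (Filter.eventually_of_mem (Metric.isOpen_ball.mem_nhds hball) (hX t ht)) (Z t) (Y t)
    have e3 := moserPrimitive_deriv_sub hΩ halt hcl hball (Y t) (Z t)
    have e4 := hcl _ hball (g (t, c t)) (Y t) (Z t)
    have halt' := fderiv_alternating hy
      (Filter.eventually_of_mem (Metric.isOpen_ball.mem_nhds hball) halt)
    have e5 := halt' (Y t) (g (t, c t)) (Z t)
    have h0 : (0 : E) ∈ Metric.ball (0 : E) r :=
      Metric.mem_ball_self (dist_nonneg.trans_lt (Metric.mem_ball.1 hball))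
    have e6 : moserForm Ω t (c t) (fderiv ℝ g (t, c t) (0, Z t)) (Y t) =
        -moserForm Ω t (c t) (Y t) (fderiv ℝ g (t, c t) (0, Z t)) := by
      simp only [moserForm, add_apply, smul_apply, sub_apply, smul_eq_mul]
      rw [halt _ hball, halt _ h0]; ring
    simp only [add_apply, sub_apply, smul_apply, neg_apply, smul_eq_mul, id_eq, one_mul]
    linear_combination (-1 : ℝ) * e1 + e2 - e6 + e3 - (1 - t) * e4 + (1 - t) * e5
  have := constant_of_derivWithin_zero (fun t ht => (hd t ht).differentiableWithinAt)
    (fun t ht => (hd t (Set.Ico_subset_Icc_self ht)).derivWithin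
      (uniqueDiffOn_Icc zero_lt_one t (Set.Ico_subset_Icc_self ht))) 1 (Set.right_mem_Icc.2 zero_le_one)
  simpa only [moserForm_zero_left, moserForm_one_left] using this

/-- The field inherits the second-order vanishing of the primitive because `moserForm` is injective
at the origin. -/
theorem moser_vectorField_zero {g : ℝ × E → E} {r : ℝ} (hr : 0 < r) (hΩ : ContDiff ℝ ∞ Ω)
    (hg : ContDiff ℝ ∞ g)
    (hX : ∀ t ∈ I, ∀ y ∈ Metric.ball (0 : E) r, Function.Injective (moserForm Ω t y) ∧
      moserForm Ω t y (g (t, y)) = -moserPrimitive Ω y) (t : I) :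
    g (t, 0) = 0 ∧ ∀ v, fderiv ℝ g (t, 0) (0, v) = 0 := by
  have hδ : ContDiff ℝ ∞ fun y => Ω 0 - Ω y := contDiff_const.sub hΩ
  have h0 : (0 : E) ∈ Metric.ball (0 : E) r := Metric.mem_ball_self hr
  obtain ⟨hi, he⟩ := hX t t.2 0 h0
  have h1 : g (t, 0) = 0 := hi (by rw [he, moserPrimitive, radialPrimitive_zero, map_zero, neg_zero])
  refine ⟨h1, fun v => hi ?_⟩
  ext w
  have := moser_vectorField_deriv hΩ hg (Filter.eventually_of_mem
    (Metric.isOpen_ball.mem_nhds h0) fun y hy => (hX t t.2 y hy).2) v w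
  rw [h1, moserPrimitive, fderiv_radialPrimitive_zero hδ (sub_self _)] at this
  simpa using this

/-- Both sides solve the same nondegenerate linear equation at `L y`, since form and primitive are
invariant. -/
theorem moser_vectorField_map {g : ℝ × E → E} {r : ℝ} (hΩ : ContDiff ℝ ∞ Ω)
    (hX : ∀ t ∈ I, ∀ y ∈ Metric.ball (0 : E) r, Function.Injective (moserForm Ω t y) ∧
      moserForm Ω t y (g (t, y)) = -moserPrimitive Ω y) {L : E ≃L[ℝ] E}
    (hL : ∀ y ∈ Metric.ball (0 : E) r, ∀ v w, Ω (L y) (L v) (L w) = Ω y v w)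
    {t : ℝ} (ht : t ∈ I) {y : E} (hy : y ∈ Metric.ball (0 : E) r)
    (hLy : L y ∈ Metric.ball (0 : E) r) : L (g (t, y)) = g (t, L y) := by
  have hδ : ContDiff ℝ ∞ fun y => Ω 0 - Ω y := contDiff_const.sub hΩ
  have h0 : (0 : E) ∈ Metric.ball (0 : E) r :=
    Metric.mem_ball_self (dist_nonneg.trans_lt (Metric.mem_ball.1 hy))
  have hL0 := hL 0 h0
  rw [map_zero] at hL0
  refine (hX t ht _ hLy).1 ?_
  ext w
  obtain ⟨w, rfl⟩ := L.surjective w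
  rw [(hX t ht _ hLy).2]
  have h1 : moserForm Ω t (L y) (L (g (t, y))) (L w) = moserForm Ω t y (g (t, y)) w := by
    simp only [moserForm, add_apply, smul_apply, sub_apply, hL y hy, hL0]
  have h2 : moserPrimitive Ω (L y) (L w) = moserPrimitive Ω y w :=
    radialPrimitive_map hδ ((convex_ball (0 : E) r).starConvex h0) (L : E →L[ℝ] E)
      (fun x hx v w => by
        simp only [sub_apply, ContinuousLinearEquiv.coe_coe, hL x hx, hL0]) hy w
  rw [h1, (hX t ht y hy).2, neg_apply, neg_apply, h2]

/-- **Equivariant Darboux–Moser theorem** at the origin of a vector space: a closed 2-form that is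
nondegenerate at the origin is the pullback of its value there by a local diffeomorphism that
commutes with any finite family of linear automorphisms preserving the form. -/
theorem exists_equivariant_moser_map [FiniteDimensional ℝ E] (hΩ : ContDiff ℝ ∞ Ω)
    (hinv : (Ω 0).IsInvertible) (halt : ∀ᶠ y in 𝓝 0, ∀ v w, Ω y v w = -Ω y w v)
    (hcl : ∀ᶠ y in 𝓝 0, ∀ u v w,
      fderiv ℝ Ω y u v w + fderiv ℝ Ω y v w u + fderiv ℝ Ω y w u v = 0)
    {ι : Type*} [Finite ι] (L : ι → E ≃L[ℝ] E)
    (hL : ∀ i, ∀ᶠ y in 𝓝 0, ∀ v w, Ω (L i y) (L i v) (L i w) = Ω y v w) :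
    ∃ (θ : E → E) (U : Set E), IsOpen U ∧ 0 ∈ U ∧ ContDiffOn ℝ ∞ θ U ∧ θ 0 = 0 ∧
      HasFDerivAt θ (ContinuousLinearMap.id ℝ E) 0 ∧
      (∀ y ∈ U, ∀ v w, Ω 0 (fderiv ℝ θ y v) (fderiv ℝ θ y w) = Ω y v w) ∧
      ∀ i, ∀ y ∈ U, θ (L i y) = L i (θ y) := by
  have : CompleteSpace E := FiniteDimensional.complete ℝ E
  obtain ⟨g, r₀, hg, hr₀, hX₀⟩ := exists_moser_vectorField hΩ hinv
  obtain ⟨r, hr, hball⟩ := Metric.eventually_nhds_iff_ball.1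
    (((((Metric.isOpen_ball (x := (0 : E))).eventually_mem (Metric.mem_ball_self hr₀)).and halt).and hcl).and (eventually_all.2 hL))
  have hX : ∀ t ∈ I, ∀ y ∈ Metric.ball (0 : E) r, Function.Injective (moserForm Ω t y) ∧
      moserForm Ω t y (g (t, y)) = -moserPrimitive Ω y := fun t ht y hy =>
    hX₀ t ht y (hball y hy).1.1.1
  have hg0 := moser_vectorField_zero hr hΩ hg hX
  obtain ⟨Γ, U₁, hU₁, h0U₁, hΓ, hΓ0, hint, huniq⟩ :=
    exists_contDiffOn_flow hg (fun t => (hg0 t).1) (fun t => (hg0 t).2)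
  have hΓd : ∀ x ∈ U₁, DifferentiableAt ℝ Γ x := fun x hx =>
    (hΓ.contDiffAt (hU₁.mem_nhds hx)).differentiableAt (by simp)
  have hΓc : ContinuousAt Γ 0 := (hΓd 0 h0U₁).continuousAt
  have hθd : ∀ x ∈ U₁, HasFDerivAt (fun x => Γ x 1)
      ((ContinuousMap.evalCLM ℝ (1 : I)).comp (fderiv ℝ Γ x)) x := fun x hx =>
    (ContinuousLinearMap.hasFDerivAt (ContinuousMap.evalCLM ℝ (1 : I) : C(I, E) →L[ℝ] E)).comp x
      (hΓd x hx).hasFDerivAt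
  have hvar : ∀ x ∈ U₁, ∀ v, fderiv ℝ Γ x v = constPathCLM E v +
      primitiveCLM E (fderiv ℝ (superposition hg) (Γ x) (fderiv ℝ Γ x v)) := fun x hx =>
    fderiv_flow_eq (hΓd x hx) (Filter.eventually_of_mem (hU₁.mem_nhds hx) hint)
  have hsmall : ∀ᶠ x in 𝓝 (0 : E), ‖Γ x‖ < r := by
    have := hΓc.norm.eventually_lt_const (u := r) (by simpa [hΓ0] using hr)
    exact this
  -- The `L i`-image of the curve from `x` satisfies the integral equation from `L i x`. As `x → 0`
  -- this path tends to the zero path, where uniqueness applies; the two norm bounds keep both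
  -- curves in the ball where the field is equivariant.
  have hequiv : ∀ i, ∀ᶠ x in 𝓝 (0 : E), Γ (L i x) 1 = L i (Γ x 1) := by
    intro i
    set M : C(I, E) →L[ℝ] C(I, E) := ((L i : E →L[ℝ] E)).compLeftContinuous ℝ I
    have hM : ∀ γ t, M γ t = L i (γ t) := fun _ _ => rfl
    have hMc : ContinuousAt (fun x => M (Γ x)) 0 := M.continuous.continuousAt.comp hΓc
    have ht : Tendsto (fun x => (L i x, M (Γ x))) (𝓝 0) (𝓝 ((0 : E), (0 : C(I, E)))) := by
      have := ((L i).continuous.continuousAt (x := 0)).prodMk hMc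
      simpa [ContinuousAt, hΓ0] using this
    have hsmall' : ∀ᶠ x in 𝓝 (0 : E), ‖M (Γ x)‖ < r :=
      hMc.norm.eventually_lt_const (by simpa [hΓ0] using hr)
    filter_upwards [ht.eventually huniq, hU₁.mem_nhds h0U₁, hsmall, hsmall'] with x hx hxU hx1 hx2
    have := hx ?_
    · exact (congrArg (fun γ => γ 1) this).symm
    · have e1 := congrArg M (hint x hxU)
      ext t
      have e2 := congrArg (fun γ => γ t) e1
      refine e2.trans ?_
      simp only [hM, ContinuousMap.add_apply, map_add, constPathCLM_apply, primitiveCLM_apply]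
      congr 1
      refine (ContinuousLinearMap.intervalIntegral_comp_comm (L i : E →L[ℝ] E)
        (((superposition hg (Γ x)).continuous.comp continuous_projIcc).intervalIntegrable
          _ _)).symm.trans ?_
      refine intervalIntegral.integral_congr fun s _ => ?_
      simp only [superposition_apply, hM]
      refine moser_vectorField_map hΩ hX (fun y hy => (hball y hy).2 i) (Subtype.prop _) ?_ ?_
      · exact mem_ball_zero_iff.2 (((Γ x).norm_coe_le_norm _).trans_lt hx1)
      · exact mem_ball_zero_iff.2 (((M (Γ x)).norm_coe_le_norm _).trans_lt hx2)
  obtain ⟨U₂, hU₂e, hU₂, h0U₂⟩ := eventually_nhds_iff.1 (hsmall.and (eventually_all.2 hequiv))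
  refine ⟨fun x => Γ x 1, U₁ ∩ U₂, hU₁.inter hU₂, ⟨h0U₁, h0U₂⟩, ?_, ?_, ?_, ?_, ?_⟩
  · exact (ContinuousMap.evalCLM ℝ (1 : I)).contDiff.comp_contDiffOn
      (hΓ.mono Set.inter_subset_left)
  · simp [hΓ0]
  · convert! hθd 0 h0U₁ using 1
    ext v
    -- Along the zero path the linearized field vanishes, so the variational equation has constant
    -- solutions and `θ` has derivative the identity at the origin.
    have hz : fderiv ℝ (superposition hg) (Γ 0) (fderiv ℝ Γ 0 v) = 0 := by
      ext t
      simp only [fderiv_superposition_apply, hΓ0]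
      exact (hg0 t).2 _
    have := congrArg (fun γ => γ 1) (hvar 0 h0U₁ v)
    simp only [hz, map_zero, add_zero, constPathCLM_apply] at this
    exact this.symm
  · intro x hx v w
    have hxU := hx.1
    have hvx := fun v t (ht : t ∈ I) => hasDerivWithinAt_of_eq_primitive (hvar x hxU v) ht
    have h := moser_pairing_constant (r := r) hΩ hg (fun y hy => (hball y hy).1.1.2)
      (fun y hy => (hball y hy).1.2) (fun t ht y hy => (hX t ht y hy).2)
      (c := fun t => Γ x (Set.projIcc 0 1 zero_le_one t))
      (Y := fun t => fderiv ℝ Γ x v (Set.projIcc 0 1 zero_le_one t))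
      (Z := fun t => fderiv ℝ Γ x w (Set.projIcc 0 1 zero_le_one t))
      (fun t _ => mem_ball_zero_iff.2 (((Γ x).norm_coe_le_norm _).trans_lt (hU₂e x hx.2).1))
      (fun t ht => by
        have := hasDerivWithinAt_of_eq_primitive (hint x hxU) ht
        rw [superposition_apply] at this
        rwa [Set.projIcc_of_mem zero_le_one ht])
      (fun t ht => by
        have := hvx v t ht
        rw [fderiv_superposition_apply] at this
        rwa [Set.projIcc_of_mem zero_le_one ht])
      (fun t ht => by
        have := hvx w t ht
        rw [fderiv_superposition_apply] at this
        rwa [Set.projIcc_of_mem zero_le_one ht])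
    have p1 : Set.projIcc (0 : ℝ) 1 zero_le_one 1 = 1 := Set.projIcc_right _
    have p0 : Set.projIcc (0 : ℝ) 1 zero_le_one 0 = 0 := Set.projIcc_left _
    simp only [p1, p0] at h
    rw [apply_zero_of_eq_primitive (hint x hxU), apply_zero_of_eq_primitive (hvar x hxU v),
      apply_zero_of_eq_primitive (hvar x hxU w)] at h
    rw [(hθd x hxU).fderiv]
    exact h
  · intro i x hx
    exact (hU₂e x hx.2).2 i

end Moser

/-! ### Symplectic linear algebra -/

section SymplecticBasis

/-- A nondegenerate alternating form has symplectic coordinates. -/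
theorem exists_symplectic_coordinates (N : ℕ) :
    ∀ {V : Type u} [AddCommGroup V] [Module ℝ V] [FiniteDimensional ℝ V],
      Module.finrank ℝ V ≤ N → ∀ B : V →ₗ[ℝ] V →ₗ[ℝ] ℝ, (∀ u, B u u = 0) →
      (∀ u, (∀ w, B u w = 0) → u = 0) →
      ∃ (n : ℕ) (e : V →ₗ[ℝ] (Fin n ⊕ Fin n → ℝ)), Function.Surjective e ∧
        ∀ u w, B u w =
          ∑ i, (e u (Sum.inr i) * e w (Sum.inl i) - e w (Sum.inr i) * e u (Sum.inl i)) := by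
  induction N with
  | zero =>
    intro V _ _ _ hN B _ _
    have : Subsingleton V := Module.finrank_zero_iff.1 (Nat.le_zero.1 hN)
    refine ⟨0, 0, fun y => ⟨0, Subsingleton.elim _ _⟩, fun u w => ?_⟩
    simp [Subsingleton.elim u 0]
  | succ N ih =>
    intro V _ _ _ hN B halt hnd
    rcases subsingleton_or_nontrivial V with hV | hV
    · refine ⟨0, 0, fun y => ⟨0, Subsingleton.elim _ _⟩, fun u w => ?_⟩
      simp [Subsingleton.elim u 0]
    obtain ⟨u, hu⟩ := exists_ne (0 : V)
    obtain ⟨w₀, hw₀⟩ : ∃ w, B u w ≠ 0 := by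
      by_contra! h
      exact hu (hnd u h)
    obtain ⟨w, hw⟩ : ∃ w, B u w = 1 := ⟨(B u w₀)⁻¹ • w₀, by simp [hw₀]⟩
    have hsk : ∀ a b, B a b = -B b a := fun a b => (LinearMap.IsAlt.neg halt b a).symm
    have hwu : B w u = -1 := by rw [hsk, hw]
    -- The symplectic complement of the hyperbolic pair `u, w`; `P` below projects onto it along
    -- their span.
    set W : Submodule ℝ V := LinearMap.ker (B u) ⊓ LinearMap.ker (B w) with hW
    have hmem : ∀ x, x - B x w • u - B u x • w ∈ W := by
      intro x
      refine ⟨?_, ?_⟩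
      · simp [halt, hw]
      · simp [halt, hwu, hsk w x]
    let P : V →ₗ[ℝ] W := LinearMap.codRestrict W
      (LinearMap.id - (B.flip w).smulRight u - (B u).smulRight w) (fun x => by
        simpa using hmem x)
    have hP : ∀ x, (P x : V) = x - B x w • u - B u x • w := fun x => by
      simp [P]
    have huW : ∀ y ∈ W, B u y = 0 := fun y hy => hy.1
    have hwW : ∀ y ∈ W, B w y = 0 := fun y hy => hy.2
    have hlt : Module.finrank ℝ W < Module.finrank ℝ V := by
      refine Submodule.finrank_lt (fun h => ?_)
      have : B u w = 0 := huW w (h ▸ Submodule.mem_top)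
      rw [hw] at this
      exact one_ne_zero this
    have hBP : ∀ x y, B x y = B (P x) (P y) + (B x w * B u y - B y w * B u x) := by
      intro x y
      simp only [hP, map_sub, map_smul, LinearMap.sub_apply, LinearMap.smul_apply, smul_eq_mul,
        halt, hw, hwu, hsk w y, hsk x u]
      ring
    obtain ⟨n, e, he, hBe⟩ := ih (V := W) (by omega)
      (B.compl₁₂ W.subtype W.subtype) (fun y => halt y) (fun y hy => by
        -- For `y ∈ W`, `B y x` depends only on `P x`, so nondegeneracy passes to `W`.
        refine Subtype.ext (hnd y fun x => ?_)
        rw [hBP]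
        have h1 : P y = y := Subtype.ext (by
          rw [hP, huW y y.2, hsk, hwW y y.2]; simp)
        have h2 : B y w = 0 := by rw [hsk, hwW y y.2, neg_zero]
        rw [h1, huW y y.2, h2]
        simpa using hy (P x))
    -- The new pair is `q = B u ·` and `p = B · w`, matching the extra term in `hBP` with the sign
    -- of `dp ∧ dq`.
    let e' : V →ₗ[ℝ] (Fin (n + 1) ⊕ Fin (n + 1) → ℝ) := LinearMap.pi fun j =>
      Sum.elim (Fin.cons (B u) fun i => (LinearMap.proj (Sum.inl i)).comp (e.comp P))
        (Fin.cons (B.flip w) fun i => (LinearMap.proj (Sum.inr i)).comp (e.comp P)) j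
    refine ⟨n + 1, e', fun c => ?_, fun x y => ?_⟩
    · obtain ⟨y, hy⟩ := he (Sum.elim (fun i => c (Sum.inl i.succ)) (fun i => c (Sum.inr i.succ)))
      have hyu : B u (y : V) = 0 := huW y y.2
      have hyw : B (y : V) w = 0 := by rw [hsk, hwW y y.2, neg_zero]
      refine ⟨y + c (Sum.inr 0) • u + c (Sum.inl 0) • w, ?_⟩
      have h1 : P (y + c (Sum.inr 0) • u + c (Sum.inl 0) • w) = y := by
        ext
        rw [hP]
        simp only [map_add, map_smul, LinearMap.add_apply, LinearMap.smul_apply, smul_eq_mul, halt,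
            hw, hyu, hyw, mul_one, mul_zero, add_zero, zero_add]
        abel
      ext (i | i) <;> refine Fin.cases ?_ (fun i => ?_) i <;>
        simp [e', hw, halt, hyu, hyw, h1, hy]
    · rw [Fin.sum_univ_succ, hBP x y, add_comm]
      congr 1
      exact hBe (P x) (P y)

end SymplecticBasis

/-! ### Alternating 2-forms as bilinear forms -/

section Bilinear

variable {E : Type*} [NormedAddCommGroup E] [NormedSpace ℝ E]

/-- Alternating 2-forms as bilinear forms. -/
noncomputable def altToBilin (E : Type*) [NormedAddCommGroup E] [NormedSpace ℝ E] :
    (E [⋀^Fin 2]→L[ℝ] ℝ) →L[ℝ] E →L[ℝ] E →L[ℝ] ℝ :=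
  (ContinuousLinearMap.compL ℝ E (E [⋀^Fin 1]→L[ℝ] ℝ) (E →L[ℝ] ℝ)
    ((ContinuousAlternatingMap.ofSubsingletonLIE (𝕜 := ℝ) (E := E) (F := ℝ) (0 : Fin 1)).symm :
      (E [⋀^Fin 1]→L[ℝ] ℝ) →L[ℝ] E →L[ℝ] ℝ)).comp
    (ContinuousAlternatingMap.curryLeftLI (𝕜 := ℝ) (E := E) (F := ℝ) (n := 1)).toContinuousLinearMap

theorem altToBilin_apply (α : E [⋀^Fin 2]→L[ℝ] ℝ) (u w : E) :
    altToBilin E α u w = α ![u, w] := by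
  change α (Matrix.vecCons u fun _ => w) = α ![u, w]
  congr 1
  ext i
  fin_cases i <;> rfl

theorem altToBilin_swap (α : E [⋀^Fin 2]→L[ℝ] ℝ) (u w : E) :
    altToBilin E α u w = -altToBilin E α w u := by
  rw [altToBilin_apply, altToBilin_apply]
  have := α.map_swap ![w, u] (i := 0) (j := 1) (by simp)
  refine Eq.trans ?_ this
  change α _ = α _
  congr 1
  ext i
  fin_cases i <;> simp

/-- The exterior derivative on `u, v, w` is an alternating sum of three derivatives; swapping the
arguments in the middle one makes it cyclic. -/
theorem fderiv_altToBilin_cyclic {α : E → E [⋀^Fin 2]→L[ℝ] ℝ} {y : E}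
    (hα : DifferentiableAt ℝ α y) (hcl : extDeriv α y = 0) (u v w : E) :
    fderiv ℝ (fun z => altToBilin E (α z)) y u v w +
      fderiv ℝ (fun z => altToBilin E (α z)) y v w u +
      fderiv ℝ (fun z => altToBilin E (α z)) y w u v = 0 := by
  have hd : DifferentiableAt ℝ (fun z => altToBilin E (α z)) y :=
    (altToBilin E).differentiableAt.comp y hα
  have key : ∀ a b c, fderiv ℝ (fun z => α z ![b, c]) y a =
      fderiv ℝ (fun z => altToBilin E (α z)) y a b c := by
    intro a b c
    simp_rw [← altToBilin_apply]
    rw [(hasFDerivAt_bilin_apply hd b c).fderiv]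
    rfl
  have h : extDeriv α y ![u, v, w] = 0 := by rw [hcl]; rfl
  rw [extDeriv_apply hα] at h
  have e0 : (0 : Fin 3).removeNth ![u, v, w] = ![v, w] := by ext i; fin_cases i <;> rfl
  have e1 : (1 : Fin 3).removeNth ![u, v, w] = ![u, w] := by ext i; fin_cases i <;> rfl
  have e2 : (2 : Fin 3).removeNth ![u, v, w] = ![u, v] := by ext i; fin_cases i <;> rfl
  replace h := (Fin.sum_univ_three (f := fun i : Fin 3 => (-1 : ℤ) ^ i.val •
    fderiv ℝ (fun z => α z (i.removeNth ![u, v, w])) y (![u, v, w] i))).symm.trans h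
  simp only [e0, e1, e2, key] at h
  have h3 := fderiv_alternating hd (Filter.Eventually.of_forall fun z a b =>
    altToBilin_swap (α z) a b) v w u
  simp at h
  linarith

/-- As a bilinear form, the pull-back is built from compositions of continuous linear maps, which
depend smoothly on their factors. -/
theorem contDiffOn_altToBilin_pullback {F : Type*} [NormedAddCommGroup F] [NormedSpace ℝ F]
    {α : F → F [⋀^Fin 2]→L[ℝ] ℝ} {s : E → F} {U : Set E} {V : Set F} (hU : IsOpen U)
    (hα : ContDiffOn ℝ ∞ α V) (hs : ContDiffOn ℝ ∞ s U) (hUV : Set.MapsTo s U V) :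
    ContDiffOn ℝ ∞
      (fun y => altToBilin E ((α (s y)).compContinuousLinearMap (fderiv ℝ s y))) U := by
  have h1 : ContDiffOn ℝ ∞ (fun y => altToBilin F (α (s y))) U :=
    (altToBilin F).contDiff.comp_contDiffOn (hα.comp hs hUV)
  have h2 : ContDiffOn ℝ ∞ (fderiv ℝ s) U := hs.fderiv_of_isOpen hU (by simp)
  have h3 := ((ContinuousLinearMap.compL ℝ E F ℝ).flip.contDiff.comp_contDiffOn h2).clm_comp
    (h1.clm_comp h2)
  refine h3.congr fun y _ => ?_
  ext u w
  rw [altToBilin_apply]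
  change _ = altToBilin F (α (s y)) (fderiv ℝ s y u) (fderiv ℝ s y w)
  rw [altToBilin_apply]
  change α (s y) _ = _
  congr 1
  ext i
  fin_cases i <;> rfl

end Bilinear

/-! ### From form-preserving maps to symplectic matrices -/

section SymplecticMatrix

open Matrix

theorem dotProduct_J_mulVec {n : ℕ} (x y : Fin n ⊕ Fin n → ℝ) :
    x ⬝ᵥ (Matrix.J (Fin n) ℝ *ᵥ y) =
      ∑ i, (x (Sum.inr i) * y (Sum.inl i) - y (Sum.inr i) * x (Sum.inl i)) := by
  obtain ⟨x₁, x₂, rfl⟩ : ∃ x₁ x₂, x = Sum.elim x₁ x₂ := ⟨_, _, (Sum.elim_comp_inl_inr x).symm⟩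
  obtain ⟨y₁, y₂, rfl⟩ : ∃ y₁ y₂, y = Sum.elim y₁ y₂ := ⟨_, _, (Sum.elim_comp_inl_inr y).symm⟩
  rw [Matrix.J, Matrix.fromBlocks_mulVec]
  simp [Matrix.neg_mulVec, dotProduct, Finset.sum_add_distrib, mul_comm, sub_eq_neg_add]

theorem mem_symplecticGroup_of_preserves {n : ℕ} {A : Matrix (Fin n ⊕ Fin n) (Fin n ⊕ Fin n) ℝ}
    (h : ∀ x y, (A *ᵥ x) ⬝ᵥ (Matrix.J (Fin n) ℝ *ᵥ (A *ᵥ y)) = x ⬝ᵥ (Matrix.J (Fin n) ℝ *ᵥ y)) :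
    A ∈ Matrix.symplecticGroup (Fin n) ℝ := by
  rw [SymplecticGroup.mem_iff']
  refine (Matrix.toBilin' (R₁ := ℝ)).injective ?_
  refine LinearMap.ext₂ fun x y => ?_
  rw [Matrix.toBilin'_apply', Matrix.toBilin'_apply', ← h x y, ← Matrix.mulVec_mulVec,
    ← Matrix.mulVec_mulVec, Matrix.dotProduct_mulVec x, Matrix.vecMul_transpose]

/-- The symplectic representation, in symplectic coordinates, of a group of automorphisms of a
symplectic vector space. -/
theorem exists_symplectic_representation {V H : Type*} [AddCommGroup V] [Module ℝ V] [Group H]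
    {n : ℕ} (e : V ≃ₗ[ℝ] (Fin n ⊕ Fin n → ℝ)) (ρ : H →* (V →ₗ[ℝ] V))
    (h : ∀ g u w, ∑ i, (e (ρ g u) (Sum.inr i) * e (ρ g w) (Sum.inl i) -
        e (ρ g w) (Sum.inr i) * e (ρ g u) (Sum.inl i)) =
      ∑ i, (e u (Sum.inr i) * e w (Sum.inl i) - e w (Sum.inr i) * e u (Sum.inl i))) :
    ∃ S : H →* Matrix.symplecticGroup (Fin n) ℝ, ∀ g v,
      e (ρ g v) = (S g : Matrix (Fin n ⊕ Fin n) (Fin n ⊕ Fin n) ℝ) *ᵥ (e v) := by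
  have hmul : ∀ g x, LinearMap.toMatrix' (e.conj (ρ g)) *ᵥ x = e (ρ g (e.symm x)) := fun g x => by
    rw [LinearMap.toMatrix'_mulVec]; rfl
  refine ⟨{ toFun := fun g => ⟨LinearMap.toMatrix' (e.conj (ρ g)), ?_⟩
            map_one' := ?_
            map_mul' := ?_ }, fun g v => ?_⟩
  · refine mem_symplecticGroup_of_preserves fun x y => ?_
    rw [hmul, hmul, dotProduct_J_mulVec, dotProduct_J_mulVec, h]
    simp
  · ext1
    simp [Module.End.one_eq_id, LinearEquiv.conj_id]
  · intro g g'
    ext1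
    change LinearMap.toMatrix' (e.conj (ρ (g * g'))) = LinearMap.toMatrix' (e.conj (ρ g)) *
      LinearMap.toMatrix' (e.conj (ρ g'))
    rw [← LinearMap.toMatrix'_mul, map_mul, Module.End.mul_eq_comp, LinearEquiv.conj_comp]
    rfl
  · change _ = LinearMap.toMatrix' (e.conj (ρ g)) *ᵥ e v
    rw [hmul, e.symm_apply_apply]

end SymplecticMatrix

/-! ### Linearization of a finite action at a fixed point -/

section FixedPoint

open Filter Topology

variable {E : Type u} [NormedAddCommGroup E] [NormedSpace ℝ E]

/-- `a` is a smooth action of `H` on the open set `V`, fixing the point `x` of `V`. -/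
structure IsSmoothActionFixing {H : Type*} [Group H] (a : H → E → E) (V : Set E) (x : E) :
    Prop where
  isOpen : IsOpen V
  mem : x ∈ V
  mapsTo : ∀ g, Set.MapsTo (a g) V V
  one : ∀ v ∈ V, a 1 v = v
  mul : ∀ g h, ∀ v ∈ V, a (g * h) v = a g (a h v)
  smooth : ∀ g, ContDiffOn ℝ ∞ (a g) V
  fix : ∀ g, a g x = x

namespace IsSmoothActionFixing

variable {H : Type*} [Group H] {a : H → E → E} {V : Set E} {x : E}

theorem differentiableAt (hA : IsSmoothActionFixing a V x) (g : H) {v : E} (hv : v ∈ V) :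
    DifferentiableAt ℝ (a g) v :=
  ((hA.smooth g).contDiffAt (hA.isOpen.mem_nhds hv)).differentiableAt (by simp)

/-- The isotropy representation. -/
noncomputable def linearPart (hA : IsSmoothActionFixing a V x) : H →* (E →L[ℝ] E) where
  toFun g := fderiv ℝ (a g) x
  map_one' := by
    have : a 1 =ᶠ[𝓝 x] id := eventually_of_mem (hA.isOpen.mem_nhds hA.mem) hA.one
    rw [this.fderiv_eq, fderiv_id]
    rfl
  map_mul' g h := by
    have : a (g * h) =ᶠ[𝓝 x] a g ∘ a h :=
      eventually_of_mem (hA.isOpen.mem_nhds hA.mem) (hA.mul g h)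
    have hg : DifferentiableAt ℝ (a g) (a h x) := by
      rw [hA.fix h]; exact hA.differentiableAt g hA.mem
    rw [this.fderiv_eq, fderiv_comp x hg (hA.differentiableAt h hA.mem), hA.fix h]
    rfl

theorem linearPart_mul_apply (hA : IsSmoothActionFixing a V x) (g h : H) (v : E) :
    hA.linearPart (g * h) v = hA.linearPart g (hA.linearPart h v) := by
  rw [map_mul]; rfl

/-- The isotropy representation, by continuous linear equivalences. -/
noncomputable def linearEquiv (hA : IsSmoothActionFixing a V x) (g : H) : E ≃L[ℝ] E :=
  ContinuousLinearEquiv.equivOfInverse (hA.linearPart g) (hA.linearPart g⁻¹)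
    (fun v => by rw [← linearPart_mul_apply, inv_mul_cancel, map_one]; rfl)
    (fun v => by rw [← linearPart_mul_apply, mul_inv_cancel, map_one]; rfl)

@[simp]
theorem linearEquiv_apply (hA : IsSmoothActionFixing a V x) (g : H) (v : E) :
    hA.linearEquiv g v = hA.linearPart g v := rfl

/-- Bochner linearization at a fixed point, by averaging. -/
theorem exists_linearization [Finite H] (hA : IsSmoothActionFixing a V x) :
    ∃ ψ : E → E, ContDiffOn ℝ ∞ ψ V ∧ ψ x = 0 ∧ HasFDerivAt ψ (ContinuousLinearMap.id ℝ E) x ∧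
      ∀ g, ∀ v ∈ V, ψ (a g v) = hA.linearPart g (ψ v) := by
  have := Fintype.ofFinite H
  have hcard : (Fintype.card H : ℝ) ≠ 0 := Nat.cast_ne_zero.2 Fintype.card_ne_zero
  -- Each summand has derivative the identity at `x`, hence so does the average; reindexing the sum
  -- by `k ↦ k * g` gives equivariance.
  refine ⟨fun v => (Fintype.card H : ℝ)⁻¹ • ∑ g, hA.linearPart g⁻¹ (a g v - x), ?_, ?_, ?_, ?_⟩
  · exact contDiffOn_const.smul (ContDiffOn.sum fun g _ =>
      (hA.linearPart g⁻¹).contDiff.comp_contDiffOn ((hA.smooth g).sub contDiffOn_const))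
  · simp [hA.fix]
  · have h1 : ∀ g ∈ Finset.univ, HasFDerivAt (fun v => hA.linearPart g⁻¹ (a g v - x))
        (ContinuousLinearMap.id ℝ E) x := by
      intro g _
      have h := (hA.linearPart g⁻¹).hasFDerivAt.comp x
        ((hA.differentiableAt g hA.mem).hasFDerivAt.sub_const x)
      convert! h using 1
      ext v
      change v = hA.linearPart g⁻¹ (hA.linearPart g v)
      rw [← linearPart_mul_apply, inv_mul_cancel, map_one]; rfl
    have h2 := (HasFDerivAt.fun_sum h1).const_smul ((Fintype.card H : ℝ)⁻¹)
    convert! h2 using 1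
    rw [Finset.sum_const, Finset.card_univ, ← Nat.cast_smul_eq_nsmul ℝ, smul_smul,
      inv_mul_cancel₀ hcard, one_smul]
  · intro g v hv
    simp only [map_smul, map_sum]
    congr 1
    rw [← Equiv.sum_comp (Equiv.mulRight g)
      (fun k => hA.linearPart g (hA.linearPart k⁻¹ (a k v - x)))]
    refine Finset.sum_congr rfl fun k _ => ?_
    rw [Equiv.coe_mulRight, ← linearPart_mul_apply, hA.mul k g v hv]
    simp

end IsSmoothActionFixing

end FixedPoint

/-! ### Darboux coordinates near a fixed point -/

section LocalDarboux

open Filter Topology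

variable {E : Type u} [NormedAddCommGroup E] [NormedSpace ℝ E]

theorem OpenPartialHomeomorph.isSmoothOpenEmbeddingOn {F : Type*}
    [NormedAddCommGroup F] [NormedSpace ℝ F] (e : OpenPartialHomeomorph E F) {M : Set E}
    (hM : IsOpen M) (hMe : M ⊆ e.source) (he : ContDiffOn ℝ ∞ e M)
    (hs : ContDiffOn ℝ ∞ e.symm e.target) : IsSmoothOpenEmbeddingOn e M := by
  refine ⟨he, e.isOpen_image_of_subset_source hM hMe, e.symm, hs.mono ?_,
    fun v hv => e.left_inv (hMe hv)⟩
  rintro _ ⟨v, hv, rfl⟩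
  exact e.map_source (hMe hv)

theorem altToBilin_pullback {F : Type*} [NormedAddCommGroup F] [NormedSpace ℝ F]
    (α : F [⋀^Fin 2]→L[ℝ] ℝ) (A : E →L[ℝ] F) (u w : E) :
    altToBilin E (α.compContinuousLinearMap A) u w = altToBilin F α (A u) (A w) := by
  rw [altToBilin_apply, altToBilin_apply]
  change α _ = α _
  congr 1
  ext i
  fin_cases i <;> rfl

namespace IsSmoothActionFixing

variable {H : Type*} [Group H] {a : H → E → E} {V : Set E} {x : E}

/-- An invariant closed 2-form near a fixed point, read in linearizing coordinates `ψ`. -/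
theorem exists_form_in_linear_coordinates [Finite H] [FiniteDimensional ℝ E]
    (hA : IsSmoothActionFixing a V x) {α : E → E [⋀^Fin 2]→L[ℝ] ℝ} (hα : ContDiffOn ℝ ∞ α V)
    (hinv : ∀ g, ∀ v ∈ V, (α (a g v)).compContinuousLinearMap (fderiv ℝ (a g) v) = α v)
    (hcl : ∀ v ∈ V, extDeriv α v = 0)
    {ψ : E → E} (hψ : ContDiffOn ℝ ∞ ψ V) (hψ0 : ψ x = 0)
    (hψ' : HasFDerivAt ψ (ContinuousLinearMap.id ℝ E) x)
    (hψL : ∀ g, ∀ v ∈ V, ψ (a g v) = hA.linearPart g (ψ v)) :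
    ∃ Ω : E → E →L[ℝ] E →L[ℝ] ℝ, ContDiff ℝ ∞ Ω ∧ Ω 0 = altToBilin E (α x) ∧
      (∀ᶠ y in 𝓝 0, ∀ v w, Ω y v w = -Ω y w v) ∧
      (∀ᶠ y in 𝓝 0, ∀ u v w,
        fderiv ℝ Ω y u v w + fderiv ℝ Ω y v w u + fderiv ℝ Ω y w u v = 0) ∧
      (∀ g, ∀ᶠ y in 𝓝 0, ∀ v w,
        Ω (hA.linearPart g y) (hA.linearPart g v) (hA.linearPart g w) = Ω y v w) ∧
      (∀ᶠ v in 𝓝 x, ∀ u w, Ω (ψ v) (fderiv ℝ ψ v u) (fderiv ℝ ψ v w) = altToBilin E (α v) u w) := by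
  have : CompleteSpace E := FiniteDimensional.complete ℝ E
  obtain ⟨e, hxe, heV, hcoe, hs, -⟩ := hψ.exists_openPartialHomeomorph hA.isOpen hA.mem
    (f' := ContinuousLinearEquiv.refl ℝ E) hψ'
  have h0 : (0 : E) ∈ e.target := by
    have := e.map_source hxe
    rwa [hcoe, hψ0] at this
  have hs0 : e.symm 0 = x := by
    have := e.left_inv hxe
    rwa [hcoe, hψ0] at this
  have hsV : Set.MapsTo e.symm e.target V := fun y hy => heV (e.map_target hy)
  have hsd : ∀ y ∈ e.target, ContDiffAt ℝ ∞ e.symm y := fun y hy =>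
    hs.contDiffAt (e.open_target.mem_nhds hy)
  have hsd' : ∀ y ∈ e.target, DifferentiableAt ℝ e.symm y := fun y hy =>
    (hsd y hy).differentiableAt (by simp)
  have hαd : ∀ v ∈ V, DifferentiableAt ℝ α v := fun v hv =>
    (hα.contDiffAt (hA.isOpen.mem_nhds hv)).differentiableAt (by simp)
  have hψd : ∀ v ∈ V, DifferentiableAt ℝ ψ v := fun v hv =>
    (hψ.contDiffAt (hA.isOpen.mem_nhds hv)).differentiableAt (by simp)
  set β : E → E [⋀^Fin 2]→L[ℝ] ℝ := fun y =>
    (α (e.symm y)).compContinuousLinearMap (fderiv ℝ e.symm y) with hβ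
  have hβd : ∀ y ∈ e.target, DifferentiableAt ℝ β y := fun y hy =>
    ((hαd _ (hsV hy)).comp y (hsd' y hy)).continuousAlternatingMapCompContinuousLinearMap
      (((hs.fderiv_of_isOpen e.open_target (m := ∞) (by simp)).contDiffAt
        (e.open_target.mem_nhds hy)).differentiableAt (by simp))
  have hβcl : ∀ y ∈ e.target, extDeriv β y = 0 := fun y hy => by
    rw [hβ, extDeriv_pullback (hαd _ (hsV hy)) (hsd y hy) (by
      rw [minSmoothness_of_isRCLikeNormedField]
      exact WithTop.coe_le_coe.2 (le_top : (2 : ℕ∞) ≤ ⊤)), hcl _ (hsV hy)]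
    rfl
  have hsm : ContDiffOn ℝ ∞ (fun y => altToBilin E (β y)) e.target :=
    contDiffOn_altToBilin_pullback e.open_target hα hs hsV
  -- `Ω` is globally smooth but agrees with the transported form only near the origin, so its
  -- properties are statements about germs.
  obtain ⟨Ω, hΩ, hΩβ⟩ := hsm.exists_contDiff_eventuallyEq e.open_target isClosed_singleton
    (Set.singleton_subset_iff.2 h0)
  rw [nhdsSet_singleton] at hΩβ
  have hinvd : ∀ v ∈ e.source, ∀ u, fderiv ℝ e.symm (ψ v) (fderiv ℝ ψ v u) = u := by
    intro v hv u
    have h1 : e.symm ∘ ψ =ᶠ[𝓝 v] id := by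
      filter_upwards [e.open_source.mem_nhds hv] with z hz
      have := e.left_inv hz
      rwa [hcoe] at this
    have hψv : ψ v ∈ e.target := by
      have := e.map_source hv
      rwa [hcoe] at this
    have h2 := h1.fderiv_eq (𝕜 := ℝ)
    rw [fderiv_comp v (hsd' _ hψv) (hψd v (heV hv)), fderiv_id] at h2
    exact congrArg (fun A => A u) h2
  have hevt : ∀ᶠ y in 𝓝 (0 : E), y ∈ e.target := e.open_target.mem_nhds h0
  refine ⟨Ω, hΩ, ?_, ?_, ?_, ?_, ?_⟩
  · rw [hΩβ.eq_of_nhds]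
    have hid : fderiv ℝ e.symm 0 = ContinuousLinearMap.id ℝ E := by
      ext u
      have := hinvd x hxe u
      rwa [hψ0, hψ'.fderiv] at this
    ext u w
    rw [hβ, altToBilin_pullback, hid, hs0]
    rfl
  · filter_upwards [hΩβ] with y hy v w
    rw [hy]
    exact altToBilin_swap _ _ _
  · filter_upwards [hΩβ.eventuallyEq_nhds, hevt] with y hy hyt u v w
    rw [hy.fderiv_eq]
    exact fderiv_altToBilin_cyclic (hβd y hyt) (hβcl y hyt) u v w
  · intro g
    have hLt : Tendsto (hA.linearPart g) (𝓝 0) (𝓝 0) :=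
      (hA.linearPart g).continuous.tendsto' _ _ (map_zero _)
    have hsc : ContinuousAt e.symm 0 := (hsd' 0 h0).continuousAt
    have hgs : ∀ᶠ y in 𝓝 (0 : E), a g (e.symm y) ∈ e.source := by
      have hc : ContinuousAt (fun y => a g (e.symm y)) 0 :=
        ContinuousAt.comp (by rw [hs0]; exact (hA.differentiableAt g hA.mem).continuousAt) hsc
      refine hc.eventually (e.open_source.mem_nhds ?_)
      change a g (e.symm 0) ∈ e.source
      rw [hs0, hA.fix g]
      exact hxe
    have hcomm : ∀ᶠ y in 𝓝 (0 : E), e.symm (hA.linearPart g y) = a g (e.symm y) := by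
      filter_upwards [hevt, hgs] with y hy hgy
      have h1 := hψL g _ (hsV hy)
      have h2 := e.right_inv hy
      have h3 := e.left_inv hgy
      rw [hcoe] at h2 h3
      rw [h2] at h1
      rw [← h1, h3]
    -- The intertwining relation is needed on a neighbourhood of `y`, in order to differentiate it
    -- there.
    filter_upwards [hcomm.eventually_nhds, hΩβ, hLt.eventually hΩβ, hevt, hLt.eventually hevt]
      with y hy hΩy hΩLy hyt hLyt v w
    have hd : ∀ u, fderiv ℝ e.symm (hA.linearPart g y) (hA.linearPart g u) =
        fderiv ℝ (a g) (e.symm y) (fderiv ℝ e.symm y u) := by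
      intro u
      have h1 : e.symm ∘ hA.linearPart g =ᶠ[𝓝 y] a g ∘ e.symm := hy
      have h2 := h1.fderiv_eq (𝕜 := ℝ)
      rw [fderiv_comp y (hsd' _ hLyt) (hA.linearPart g).differentiableAt,
        fderiv_comp y (hA.differentiableAt g (hsV hyt)) (hsd' y hyt),
        ContinuousLinearMap.fderiv] at h2
      exact congrArg (fun A => A u) h2
    rw [hΩy, hΩLy, hβ, altToBilin_pullback, altToBilin_pullback, hd, hd, hy.self_of_nhds,
      ← altToBilin_pullback, hinv g _ (hsV hyt)]
  · have hψt : Tendsto ψ (𝓝 x) (𝓝 0) := by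
      have := (hψd x hA.mem).continuousAt
      rwa [ContinuousAt, hψ0] at this
    filter_upwards [hψt.eventually hΩβ, e.open_source.mem_nhds hxe] with v hv hve u w
    have := e.left_inv hve
    rw [hcoe] at this
    rw [hv, hβ, altToBilin_pullback, hinvd v hve, hinvd v hve, this]

/-- **Equivariant Darboux theorem** near a fixed point of a smooth finite group action. -/
theorem exists_darboux_coordinates [Finite H] [FiniteDimensional ℝ E]
    (hA : IsSmoothActionFixing a V x) {α : E → E [⋀^Fin 2]→L[ℝ] ℝ} (hα : ContDiffOn ℝ ∞ α V)
    (hinv : ∀ g, ∀ v ∈ V, (α (a g v)).compContinuousLinearMap (fderiv ℝ (a g) v) = α v)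
    (hcl : ∀ v ∈ V, extDeriv α v = 0) (hnd : ∀ u, (∀ w, α x ![u, w] = 0) → u = 0) :
    ∃ (N : Set E) (n : ℕ) (κ : E → Fin n ⊕ Fin n → ℝ) (S : H →* Matrix.symplecticGroup (Fin n) ℝ),
      IsOpen N ∧ x ∈ N ∧ N ⊆ V ∧ (∀ M, IsOpen M → M ⊆ N → IsSmoothOpenEmbeddingOn κ M) ∧
      κ x = 0 ∧ (∀ v ∈ N, ∀ u w, α v ![u, w] = darbouxForm κ v u w) ∧
      ∀ g, ∀ v ∈ N,
        κ (a g v) = (S g : Matrix (Fin n ⊕ Fin n) (Fin n ⊕ Fin n) ℝ).mulVec (κ v) := by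
  have : CompleteSpace E := FiniteDimensional.complete ℝ E
  obtain ⟨ψ, hψ, hψ0, hψ', hψL⟩ := hA.exists_linearization
  obtain ⟨Ω, hΩ, hΩ0, halt, hΩcl, hΩinv, hΩψ⟩ :=
    hA.exists_form_in_linear_coordinates hα hinv hcl hψ hψ0 hψ' hψL
  have hndΩ : ∀ u, (∀ w, Ω 0 u w = 0) → u = 0 := fun u hu => hnd u fun w => by
    rw [← altToBilin_apply, ← hΩ0, hu]
  have hker : LinearMap.ker (Ω 0 : E →ₗ[ℝ] E →L[ℝ] ℝ) = ⊥ :=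
    LinearMap.ker_eq_bot'.2 fun u hu => hndΩ u fun w => congrArg (fun A => A w) hu
  have hIsInv : (Ω 0).IsInvertible := by
    have hfr : Module.finrank ℝ E = Module.finrank ℝ (E →L[ℝ] ℝ) := by
      rw [← (LinearMap.toContinuousLinearMap : (E →ₗ[ℝ] ℝ) ≃ₗ[ℝ] E →L[ℝ] ℝ).finrank_eq]
      exact (Subspace.dual_finrank_eq).symm
    exact ⟨(LinearEquiv.ofInjectiveOfFinrankEq (Ω 0 : E →ₗ[ℝ] E →L[ℝ] ℝ)
      (LinearMap.ker_eq_bot.1 hker) hfr).toContinuousLinearEquiv, by ext; rfl⟩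
  obtain ⟨θ, U, hU, h0U, hθ, hθ0, hθ', hθΩ, hθL⟩ :=
    exists_equivariant_moser_map hΩ hIsInv halt hΩcl hA.linearEquiv hΩinv
  let B : E →ₗ[ℝ] E →ₗ[ℝ] ℝ :=
    (ContinuousLinearMap.coeLM ℝ).comp (Ω 0 : E →ₗ[ℝ] E →L[ℝ] ℝ)
  have hB : ∀ u w, B u w = Ω 0 u w := fun _ _ => rfl
  obtain ⟨n, l, hlsurj, hl⟩ := exists_symplectic_coordinates (Module.finrank ℝ E) le_rfl B
    (fun u => by
      have := halt.self_of_nhds u u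
      rw [hB]; linarith)
    hndΩ
  have hlinj : Function.Injective l := by
    rw [← LinearMap.ker_eq_bot]
    refine LinearMap.ker_eq_bot'.2 fun u hu => hndΩ u fun w => ?_
    rw [← hB, hl, hu]
    simp
  let ε : E ≃ₗ[ℝ] (Fin n ⊕ Fin n → ℝ) := LinearEquiv.ofBijective l ⟨hlinj, hlsurj⟩
  let εc : E ≃L[ℝ] (Fin n ⊕ Fin n → ℝ) := ε.toContinuousLinearEquiv
  have hεB : ∀ u w, ∑ i, (ε u (Sum.inr i) * ε w (Sum.inl i) - ε w (Sum.inr i) * ε u (Sum.inl i)) =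
      Ω 0 u w := fun u w => (hl u w).symm
  let ρ : H →* (E →ₗ[ℝ] E) :=
    { toFun := fun g => (hA.linearPart g : E →ₗ[ℝ] E)
      map_one' := by rw [map_one]; rfl
      map_mul' := fun g h => by rw [map_mul]; rfl }
  obtain ⟨S, hS⟩ := exists_symplectic_representation ε ρ (fun g u w => by
    rw [hεB, hεB]
    have := (hΩinv g).self_of_nhds u w
    rwa [map_zero] at this)
  obtain ⟨V₁, hV₁Ω, hV₁, hxV₁⟩ := eventually_nhds_iff.1 hΩψ
  set N₀ : Set E := (V ∩ ψ ⁻¹' U) ∩ V₁ with hN₀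
  have hN₀o : IsOpen N₀ := (hψ.continuousOn.isOpen_inter_preimage hA.isOpen hU).inter hV₁
  have hxN₀ : x ∈ N₀ := ⟨⟨hA.mem, by rw [Set.mem_preimage, hψ0]; exact h0U⟩, hxV₁⟩
  -- Linearize, apply the Moser map, then take symplectic linear coordinates. The first two have
  -- derivative the identity at the base points, so `κ` is a local diffeomorphism at `x`.
  set κ : E → Fin n ⊕ Fin n → ℝ := fun v => εc (θ (ψ v)) with hκ
  have hκs : ContDiffOn ℝ ∞ κ N₀ := εc.contDiff.comp_contDiffOn
    (hθ.comp (hψ.mono fun v hv => hv.1.1) fun v hv => hv.1.2)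
  have hψd : ∀ v ∈ N₀, HasFDerivAt ψ (fderiv ℝ ψ v) v := fun v hv =>
    ((hψ.contDiffAt (hA.isOpen.mem_nhds hv.1.1)).differentiableAt (by simp)).hasFDerivAt
  have hθd : ∀ v ∈ N₀, HasFDerivAt θ (fderiv ℝ θ (ψ v)) (ψ v) := fun v hv =>
    ((hθ.contDiffAt (hU.mem_nhds hv.1.2)).differentiableAt (by simp)).hasFDerivAt
  have hκd : ∀ v ∈ N₀, HasFDerivAt κ ((εc : E →L[ℝ] (Fin n ⊕ Fin n → ℝ)).comp
      ((fderiv ℝ θ (ψ v)).comp (fderiv ℝ ψ v))) v := fun v hv =>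
    εc.hasFDerivAt.comp v ((hθd v hv).comp v (hψd v hv))
  have hκx : HasFDerivAt κ (εc : E →L[ℝ] (Fin n ⊕ Fin n → ℝ)) x := by
    convert! hκd x hxN₀ using 1
    rw [hψ0, hθ'.fderiv, hψ'.fderiv]
    rfl
  obtain ⟨e, hxe, heN, hcoe, hes, -⟩ := hκs.exists_openPartialHomeomorph hN₀o hxN₀ hκx
  refine ⟨e.source, n, κ, S, e.open_source, hxe, fun v hv => (heN hv).1.1, ?_, ?_, ?_, ?_⟩
  -- All open subsets are treated at once, since the final chart domain is a slice chosen inside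
  -- this neighbourhood.
  · intro M hM hMe
    rw [← hcoe]
    exact OpenPartialHomeomorph.isSmoothOpenEmbeddingOn e hM hMe
      (hcoe ▸ hκs.mono (hMe.trans heN)) hes
  · simp [hκ, hψ0, hθ0]
  · intro v hv u w
    have hvN := heN hv
    have hpi := fun j => (hasFDerivAt_pi'.1 (hκd v hvN) j).fderiv
    have hval : ∀ j z, fderiv ℝ (fun x => κ x j) v z =
        ε (fderiv ℝ θ (ψ v) (fderiv ℝ ψ v z)) j := by
      intro j z
      rw [hpi j]
      rfl
    simp only [darbouxForm, hval]
    rw [hεB, hθΩ _ hvN.1.2, hV₁Ω v hvN.2, altToBilin_apply]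
  · intro g v hv
    have hvN := heN hv
    simp only [hκ]
    rw [hψL g v hvN.1.1]
    have := hθL g (ψ v) hvN.1.2
    rw [linearEquiv_apply, linearEquiv_apply] at this
    rw [this]
    exact hS g (θ (ψ v))

end IsSmoothActionFixing

end LocalDarboux

/-! ### Smooth open embeddings -/

section OrbifoldCharts

open Filter Topology

namespace IsSmoothOpenEmbeddingOn

variable {E F G : Type*} [NormedAddCommGroup E] [NormedSpace ℝ E]
    [NormedAddCommGroup F] [NormedSpace ℝ F] [NormedAddCommGroup G] [NormedSpace ℝ G]

/-- The image of `M` is open because it is the preimage of `M` under the inverse, within the open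
image of `V`. -/
theorem mono {f : E → F} {V M : Set E} (hf : IsSmoothOpenEmbeddingOn f V) (hM : IsOpen M)
    (hMV : M ⊆ V) : IsSmoothOpenEmbeddingOn f M := by
  obtain ⟨hs, ho, h, hh, hinv⟩ := hf
  have himg : f '' M = f '' V ∩ h ⁻¹' M := by
    ext y
    constructor
    · rintro ⟨v, hv, rfl⟩
      exact ⟨⟨v, hMV hv, rfl⟩, by rwa [Set.mem_preimage, hinv v (hMV hv)]⟩
    · rintro ⟨⟨v, hv, rfl⟩, hy⟩
      rw [Set.mem_preimage, hinv v hv] at hy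
      exact ⟨v, hy, rfl⟩
  refine ⟨hs.mono hMV, ?_, h, hh.mono (Set.image_mono hMV), fun v hv => hinv v (hMV hv)⟩
  rw [himg]
  exact hh.continuousOn.isOpen_inter_preimage ho hM

theorem comp {f : E → F} {g : F → G} {V : Set E} {W : Set F} (hg : IsSmoothOpenEmbeddingOn g W)
    (hf : IsSmoothOpenEmbeddingOn f V) (h : Set.MapsTo f V W) :
    IsSmoothOpenEmbeddingOn (g ∘ f) V := by
  obtain ⟨gs, go, g', hg', ginv⟩ := hg.mono hf.2.1 h.image_subset
  obtain ⟨fs, fo, f', hf', finv⟩ := hf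
  refine ⟨gs.comp fs (Set.mapsTo_image f V), by rwa [Set.image_comp], f' ∘ g', ?_, fun v hv => ?_⟩
  · rw [Set.image_comp]
    refine hf'.comp hg' ?_
    rintro _ ⟨y, hy, rfl⟩
    rwa [ginv y hy]
  · simp only [Function.comp_apply]
    rw [ginv _ ⟨v, hv, rfl⟩, finv v hv]

theorem id {V : Set E} (hV : IsOpen V) : IsSmoothOpenEmbeddingOn (id : E → E) V := by
  refine ⟨contDiffOn_id, by rwa [Set.image_id], _root_.id, contDiffOn_id, fun _ _ => rfl⟩

end IsSmoothOpenEmbeddingOn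

/-! ### Effectiveness and slices for finite actions -/

namespace SmoothFiniteAction

variable (A : SmoothFiniteAction)

theorem act_inv_act (g : A.G) {v : A.Space} (hv : v ∈ A.V) : A.act g⁻¹ (A.act g v) = v :=
  A.act_inv hv rfl

theorem act_act_inv (g : A.G) {v : A.Space} (hv : v ∈ A.V) : A.act g (A.act g⁻¹ v) = v := by
  rw [← A.act_mul _ _ _ hv, mul_inv_cancel, A.act_one _ hv]

theorem isSmoothOpenEmbeddingOn_act (g : A.G) : IsSmoothOpenEmbeddingOn (A.act g) A.V := by
  have himg : A.act g '' A.V = A.V := by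
    refine Set.Subset.antisymm ?_ fun v hv => ⟨_, A.act_mem g⁻¹ v hv, A.act_act_inv g hv⟩
    rintro _ ⟨v, hv, rfl⟩
    exact A.act_mem g v hv
  refine ⟨A.act_smooth g, ?_, A.act g⁻¹, ?_, fun v hv => A.act_inv_act g hv⟩
  · rw [himg]; exact A.isOpen_V
  · rw [himg]; exact A.act_smooth g⁻¹

theorem continuousAt_act (g : A.G) {v : A.Space} (hv : v ∈ A.V) : ContinuousAt (A.act g) v :=
  (A.act_smooth g).continuousOn.continuousAt (A.isOpen_V.mem_nhds hv)

theorem isSmoothActionFixing {H : Subgroup A.G} {x : A.Space} (hx : x ∈ A.V)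
    (h : ∀ g ∈ H, A.act g x = x) :
    IsSmoothActionFixing (fun g : H => A.act g) A.V x where
  isOpen := A.isOpen_V
  mem := hx
  mapsTo g := A.act_mem g
  one := A.act_one
  mul g h := A.act_mul g h
  smooth g := A.act_smooth g
  fix g := h g g.2

/-- The elements that act as the identity near a given point. -/
def germStabilizer {v : A.Space} (hv : v ∈ A.V) : Subgroup A.G where
  carrier := {g | ∀ᶠ w in 𝓝 v, A.act g w = w}
  one_mem' := eventually_of_mem (A.isOpen_V.mem_nhds hv) A.act_one
  mul_mem' {g h} hg hh := by
    filter_upwards [hg, hh, A.isOpen_V.mem_nhds hv] with w h1 h2 h3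
    rw [A.act_mul _ _ _ h3, h2, h1]
  inv_mem' {g} hg := by
    filter_upwards [hg, A.isOpen_V.mem_nhds hv] with w h1 h2
    exact A.act_inv h2 h1

/-- An effective action is effective on every nonempty open subset. -/
theorem eq_one_of_eventually {g : A.G} {v₀ : A.Space} (hv₀ : v₀ ∈ A.V)
    (h : ∀ᶠ w in 𝓝 v₀, A.act g w = w) : g = 1 := by
  -- `S` is open; by connectedness of `V` it suffices that `S` is relatively closed. At a limit
  -- point `y`, the powers of `g` fix `y` with derivative the identity by continuity, so
  -- linearization conjugates `g` to the identity near `y`.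
  set S : Set A.Space := {v | ∀ᶠ w in 𝓝 v, A.act g w = w}
  have hS : IsOpen S := isOpen_setOfPred_eventually_nhds
  have hVS : A.V ⊆ S := by
    refine A.isConnected_V.isPreconnected.subset_of_closure_inter_subset hS ⟨v₀, hv₀, h⟩ ?_
    rintro y ⟨hyS, hyV⟩
    have hfreq : ∃ᶠ v in 𝓝 y, v ∈ S ∧ v ∈ A.V :=
      (mem_closure_iff_frequently.1 hyS).and_eventually (A.isOpen_V.mem_nhds hyV)
    have hgerm : ∀ k ∈ Subgroup.zpowers g, ∀ v ∈ S, v ∈ A.V → ∀ᶠ w in 𝓝 v, A.act k w = w :=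
      fun k hk v hv hvV =>
        (Subgroup.zpowers_le (H := A.germStabilizer hvV)).2 hv hk
    have hfix : ∀ k ∈ Subgroup.zpowers g, A.act k y = y := by
      intro k hk
      by_contra hne
      have := ((A.continuousAt_act k hyV).prodMk continuousAt_id).eventually
        (isOpen_ne_fun continuous_fst continuous_snd |>.mem_nhds hne)
      obtain ⟨v, ⟨hvS, hvV⟩, hv⟩ := (hfreq.and_eventually this).exists
      exact hv (hgerm k hk v hvS hvV).self_of_nhds
    have hA := A.isSmoothActionFixing hyV hfix
    have hlin : ∀ k, hA.linearPart k = ContinuousLinearMap.id ℝ _ := by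
      intro k
      by_contra hne
      have hc : ContinuousAt (fderiv ℝ (A.act k)) y :=
        ((A.act_smooth k).contDiffAt (A.isOpen_V.mem_nhds hyV)).continuousAt_fderiv (by simp)
      have := hc.eventually (isOpen_ne.mem_nhds hne)
      obtain ⟨v, ⟨hvS, hvV⟩, hv⟩ := (hfreq.and_eventually this).exists
      refine hv ?_
      have : A.act k =ᶠ[𝓝 v] id := hgerm k k.2 v hvS hvV
      rw [this.fderiv_eq, fderiv_id]
    obtain ⟨ψ, hψ, -, hψ', hψg⟩ := hA.exists_linearization
    obtain ⟨e, hye, heV, hcoe, -, -⟩ := hψ.exists_openPartialHomeomorph A.isOpen_V hyV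
      (f' := ContinuousLinearEquiv.refl ℝ _) hψ'
    have hgy : A.act g y = y := hfix g (Subgroup.mem_zpowers g)
    have hev : ∀ᶠ v in 𝓝 y, A.act g v ∈ e.source :=
      (A.continuousAt_act g hyV).eventually (e.open_source.mem_nhds (by rwa [hgy]))
    filter_upwards [hev, e.open_source.mem_nhds hye] with v hgv hv
    refine e.injOn hgv hv ?_
    rw [hcoe]
    have := hψg ⟨g, Subgroup.mem_zpowers g⟩ v (heV hv)
    rw [hlin] at this
    exact this
  exact A.effective g fun v hv => (hVS hv).self_of_nhds

/-- `W` is a connected open slice at `x`: it is invariant under the stabilizer of `x`, and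
only elements of the stabilizer move a point of `W` to a point of `W`. -/
structure IsSlice (x : A.Space) (hx : x ∈ A.V) (W : Set A.Space) : Prop where
  isOpen : IsOpen W
  isConnected : IsConnected W
  subset : W ⊆ A.V
  mem : x ∈ W
  mapsTo : ∀ g ∈ A.stabilizer x hx, Set.MapsTo (A.act g) W W
  mem_stabilizer : ∀ g, ∀ v ∈ W, A.act g v ∈ W → g ∈ A.stabilizer x hx

/-- Hausdorffness separates `x` from each translate `g x ≠ x`. Intersecting over the finite group,
and then over preimages under the stabilizer, gives an invariant open set; the stabilizer preserves
its connected component containing `x`, since it fixes `x`. -/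
theorem exists_isSlice {x : A.Space} (hx : x ∈ A.V) {N : Set A.Space} (hN : N ∈ 𝓝 x) :
    ∃ W, A.IsSlice x hx W ∧ W ⊆ N := by
  have hsep : ∀ g : A.G, ∃ M ∈ 𝓝 x, g ∉ A.stabilizer x hx → ∀ v ∈ M, A.act g v ∉ M := by
    intro g
    by_cases hg : g ∈ A.stabilizer x hx
    · exact ⟨Set.univ, univ_mem, fun h => (h hg).elim⟩
    · have hne : A.act g x ≠ x := hg
      obtain ⟨B, C, hB, hC, hgB, hxC, hBC⟩ := t2_separation hne
      refine ⟨C ∩ A.act g ⁻¹' B, inter_mem (hC.mem_nhds hxC)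
        (A.continuousAt_act g hx (hB.mem_nhds hgB)), fun _ v hv hgv => ?_⟩
      exact Set.disjoint_left.1 hBC hv.2 hgv.1
  choose M hM hMsep using hsep
  have hM₀ : N ∩ A.V ∩ ⋂ g, M g ∈ 𝓝 x :=
    inter_mem (inter_mem hN (A.isOpen_V.mem_nhds hx)) (iInter_mem.2 hM)
  obtain ⟨M₀, hM₀sub, hM₀o, hxM₀⟩ := mem_nhds_iff.1 hM₀
  set M₁ : Set A.Space := ⋂ h : A.stabilizer x hx, A.V ∩ A.act h ⁻¹' M₀ with hM₁
  have hM₁o : IsOpen M₁ := isOpen_iInter_of_finite fun h =>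
    (A.act_smooth h).continuousOn.isOpen_inter_preimage A.isOpen_V hM₀o
  have hxM₁ : x ∈ M₁ := Set.mem_iInter.2 fun h => ⟨hx, by
    rw [Set.mem_preimage, show A.act h x = x from h.2]; exact hxM₀⟩
  have hM₁V : M₁ ⊆ A.V := fun v hv => (Set.mem_iInter.1 hv 1).1
  have hM₁M₀ : M₁ ⊆ M₀ := fun v hv => by
    have := (Set.mem_iInter.1 hv 1).2
    rwa [Set.mem_preimage, OneMemClass.coe_one, A.act_one v (hM₁V hv)] at this
  have hM₁inv : ∀ g ∈ A.stabilizer x hx, Set.MapsTo (A.act g) M₁ M₁ := by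
    intro g hg v hv
    refine Set.mem_iInter.2 fun h => ⟨A.act_mem g v (hM₁V hv), ?_⟩
    have := (Set.mem_iInter.1 hv (h * ⟨g, hg⟩)).2
    rwa [Set.mem_preimage, Subgroup.coe_mul, A.act_mul _ _ v (hM₁V hv)] at this
  have hWsub : connectedComponentIn M₁ x ⊆ M₁ := connectedComponentIn_subset _ _
  refine ⟨connectedComponentIn M₁ x, ⟨hM₁o.connectedComponentIn,
    isConnected_connectedComponentIn_iff.2 hxM₁, hWsub.trans hM₁V,
    mem_connectedComponentIn hxM₁, ?_, ?_⟩, fun v hv => (hM₀sub (hM₁M₀ (hWsub hv))).1.1⟩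
  · intro g hg
    rw [Set.mapsTo_iff_image_subset]
    refine IsPreconnected.subset_connectedComponentIn
      (isPreconnected_connectedComponentIn.image _
        ((A.act_smooth g).continuousOn.mono (hWsub.trans hM₁V)))
      ⟨x, mem_connectedComponentIn hxM₁, hg⟩ ?_
    exact ((hM₁inv g hg).mono_left hWsub).image_subset
  · intro g v hv hgv
    by_contra hg
    have h1 := fun w (hw : w ∈ connectedComponentIn M₁ x) => Set.mem_iInter.1 (hM₀sub (hM₁M₀ (hWsub hw))).2 g
    exact hMsep g hg v (h1 v hv) (h1 _ hgv)

variable {A}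

/-- The action of the stabilizer of `x` on a slice at `x`. -/
def IsSlice.action {x : A.Space} {hx : x ∈ A.V} {W : Set A.Space} (hW : A.IsSlice x hx W) :
    SmoothFiniteAction where
  dim := A.dim
  V := W
  isOpen_V := hW.isOpen
  isConnected_V := hW.isConnected
  G := A.stabilizer x hx
  act := fun (h : A.stabilizer x hx) => A.act h
  act_mem g := hW.mapsTo g g.2
  act_one v hv := A.act_one v (hW.subset hv)
  act_mul g h v hv := A.act_mul g h v (hW.subset hv)
  act_smooth g := (A.act_smooth g).mono hW.subset
  effective _ hg := Subtype.ext (A.eq_one_of_eventually hx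
    (eventually_of_mem (hW.isOpen.mem_nhds hW.mem) hg))

end SmoothFiniteAction

/-! ### Restriction of orbifold charts to slices -/

namespace OrbifoldChart

variable {X : Type*} [TopologicalSpace X]

/-- The saturation of `W` is the union of its preimages under the group elements, hence open, so its
image in the orbit space is open. -/
theorem isOpenMap_π (C : OrbifoldChart X) {W : Set C.Space} (hW : IsOpen W) (hWV : W ⊆ C.V) :
    IsOpen (C.π '' W) := by
  set q : C.V → Quotient C.orbitSetoid := Quotient.mk _
  have hpre : q ⁻¹' (q '' (Subtype.val ⁻¹' W)) =
      ⋃ g, {v : C.V | C.act g v ∈ W} := by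
    ext v
    simp only [Set.mem_preimage, Set.mem_image, Set.mem_iUnion, Set.mem_ofPred_eq]
    constructor
    · rintro ⟨w, hw, hwv⟩
      obtain ⟨g, hg⟩ := Quotient.exact hwv.symm
      exact ⟨g, hg ▸ hw⟩
    · rintro ⟨g, hg⟩
      exact ⟨⟨C.act g v, C.act_mem g v v.2⟩, hg, (Quotient.sound ⟨g, rfl⟩ : q v = q _).symm⟩
  have hq : IsOpen (q '' (Subtype.val ⁻¹' W)) := by
    rw [← isQuotientMap_quotient_mk'.isOpen_preimage]
    change IsOpen (q ⁻¹' (q '' (Subtype.val ⁻¹' W)))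
    rw [hpre]
    refine isOpen_iUnion fun g => ?_
    exact hW.preimage (continuousOn_iff_continuous_domRestrict.1 (C.act_smooth g).continuousOn)
  have := C.isOpenEmbedding_π.isOpenMap _ hq
  convert! this using 1
  rw [Set.image_image]
  ext y
  constructor
  · rintro ⟨v, hv, rfl⟩
    exact ⟨⟨v, hWV hv⟩, hv, rfl⟩
  · rintro ⟨v, hv, rfl⟩
    exact ⟨v, hv, rfl⟩

theorem continuousOn_π (C : OrbifoldChart X) : ContinuousOn C.π C.V := by
  rw [continuousOn_iff_continuous_domRestrict]
  exact C.isOpenEmbedding_π.continuous.comp continuous_quotient_mk'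

theorem exists_act_eq (C : OrbifoldChart X) {v w : C.Space} (hv : v ∈ C.V) (hw : w ∈ C.V)
    (h : C.π v = C.π w) : ∃ g, C.act g v = w :=
  Quotient.exact (C.isOpenEmbedding_π.injective (a₁ := Quotient.mk _ ⟨v, hv⟩)
    (a₂ := Quotient.mk _ ⟨w, hw⟩) h)

/-- The restriction of a chart to a slice. -/
def restrict (C : OrbifoldChart X) {x : C.Space} {hx : x ∈ C.V} {W : Set C.Space}
    (hW : C.IsSlice x hx W) : OrbifoldChart X where
  toSmoothFiniteAction := hW.action
  π := C.π
  π_act := fun (g : C.stabilizer x hx) v hv => C.π_act g v (hW.subset hv)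
  isOpenEmbedding_π := by
    refine .of_continuous_injective_isOpenMap ?_ ?_ ?_
    · exact continuous_quot_lift _ (continuousOn_iff_continuous_domRestrict.1
        (C.continuousOn_π.mono hW.subset))
    -- Points of the slice in one orbit of the full group already lie in one orbit of the
    -- stabilizer.
    · rintro ⟨v, hv⟩ ⟨w, hw⟩ hvw
      obtain ⟨g, hg⟩ := C.exists_act_eq (hW.subset hv) (hW.subset hw) hvw
      refine Quotient.sound ⟨⟨g, hW.mem_stabilizer g v hv (hg ▸ hw)⟩, hg⟩
    · intro O hO
      have h1 : IsOpen (Subtype.val '' (Quotient.mk hW.action.orbitSetoid ⁻¹' O)) :=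
        hW.isOpen.isOpenMap_subtype_val _ (hO.preimage continuous_quotient_mk')
      have h2 := C.isOpenMap_π h1 (by
        rintro _ ⟨v, -, rfl⟩
        exact hW.subset v.2)
      convert! h2 using 1
      ext y
      constructor
      · rintro ⟨⟨v⟩, hv, rfl⟩
        exact ⟨v.1, ⟨v, hv, rfl⟩, rfl⟩
      · rintro ⟨_, ⟨v, hv, rfl⟩, rfl⟩
        exact ⟨_, hv, rfl⟩

namespace Embedding

/-- The inclusion of a slice. -/
def ofSlice {C : OrbifoldChart X} {x : C.Space} {hx : x ∈ C.V} {W : Set C.Space}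
    (hW : C.IsSlice x hx W) : Embedding (C.restrict hW) C where
  toFun v := v
  mapsTo _ hv := hW.subset hv
  isSmoothOpenEmbeddingOn := IsSmoothOpenEmbeddingOn.id hW.isOpen
  hom := (C.stabilizer x hx).subtype
  hom_injective := Subtype.val_injective
  equivariant _ _ _ := rfl
  π_toFun _ _ := rfl

/-- Composition of embeddings. -/
def comp {C D K : OrbifoldChart X} (e : Embedding C D) (f : Embedding K C) : Embedding K D where
  toFun := e.toFun ∘ f.toFun
  mapsTo := e.mapsTo.comp f.mapsTo
  isSmoothOpenEmbeddingOn := e.isSmoothOpenEmbeddingOn.comp f.isSmoothOpenEmbeddingOn f.mapsTo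
  hom := e.hom.comp f.hom
  hom_injective := e.hom_injective.comp f.hom_injective
  equivariant g v hv := by
    simp only [Function.comp_apply, MonoidHom.comp_apply]
    rw [f.equivariant g v hv, e.equivariant _ _ (f.mapsTo hv)]
  π_toFun v hv := (e.π_toFun _ (f.mapsTo hv)).trans (f.π_toFun v hv)

/-- The automorphism of a chart given by an element of its group. -/
def ofGroup {C : OrbifoldChart X} (g : C.G) : Embedding C C where
  toFun := C.act g
  mapsTo := C.act_mem g
  isSmoothOpenEmbeddingOn := C.isSmoothOpenEmbeddingOn_act g
  hom := (MulAut.conj g).toMonoidHom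
  hom_injective := (MulAut.conj g).injective
  equivariant h v hv := by
    change C.act g (C.act h v) = C.act (g * h * g⁻¹) (C.act g v)
    rw [← C.act_mul _ _ _ hv, ← C.act_mul _ _ _ hv, inv_mul_cancel_right]
  π_toFun := C.π_act g

/-- An embedding with image in a slice, and a fixed point, is an embedding in the slice. -/
def codRestrict {C K : OrbifoldChart X} {x : C.Space} {hx : x ∈ C.V} {W : Set C.Space}
    (hW : C.IsSlice x hx W) (e : Embedding K C) (h : Set.MapsTo e.toFun K.V W) :
    Embedding K (C.restrict hW) where
  toFun := e.toFun
  mapsTo := h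
  isSmoothOpenEmbeddingOn := e.isSmoothOpenEmbeddingOn
  -- By equivariance the image of `g` moves a point of `W` into `W`, so the slice property places it
  -- in the stabilizer.
  hom := e.hom.codRestrict (C.stabilizer x hx) fun g => by
    obtain ⟨v, hv⟩ := K.isConnected_V.nonempty
    refine hW.mem_stabilizer _ _ (h hv) ?_
    rw [← e.equivariant g v hv]
    exact h (K.act_mem g v hv)
  hom_injective g g' hgg' := e.hom_injective (congrArg Subtype.val hgg')
  equivariant := e.equivariant
  π_toFun := e.π_toFun

end Embedding

/-- A common chart `K` may reach only another point of the orbit of `w`. Composing its embedding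
with a group element corrects this, and shrinking `K` to a slice puts its image inside `W`. -/
theorem Compatible.restrict {C A : OrbifoldChart X} (h : C.Compatible A) {x : C.Space}
    {hx : x ∈ C.V} {W : Set C.Space} (hW : C.IsSlice x hx W) : (C.restrict hW).Compatible A := by
  rintro y ⟨⟨w, hw, rfl⟩, hyA⟩
  have hwV : w ∈ C.V := hW.subset hw
  obtain ⟨K, ⟨k, hk, hkw⟩, hKU, ⟨e⟩, ⟨f⟩⟩ := h (C.π w) ⟨⟨w, hwV, rfl⟩, hyA⟩
  obtain ⟨g, hg⟩ := C.exists_act_eq (e.mapsTo hk) hwV ((e.π_toFun k hk).trans hkw)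
  set e' : Embedding K C := (Embedding.ofGroup g).comp e
  have he'k : e'.toFun k = w := hg
  have hc : ContinuousAt e'.toFun k :=
    e'.isSmoothOpenEmbeddingOn.1.continuousOn.continuousAt (K.isOpen_V.mem_nhds hk)
  obtain ⟨M, hM, hMW⟩ := K.exists_isSlice hk (hc (by rw [he'k]; exact hW.isOpen.mem_nhds hw))
  refine ⟨K.restrict hM, ⟨k, hM.mem, hkw⟩, ?_,
    ⟨Embedding.codRestrict hW (e'.comp (Embedding.ofSlice hM)) hMW⟩,
    ⟨f.comp (Embedding.ofSlice hM)⟩⟩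
  rintro _ ⟨v, hv, rfl⟩
  refine ⟨⟨e'.toFun v, hMW hv, e'.π_toFun v (hM.subset hv)⟩, ?_⟩
  exact (hKU ⟨v, hM.subset hv, rfl⟩).2

end OrbifoldChart

end OrbifoldCharts

/-! ### Assembly on the orbifold -/

/-- The isotropy group `G_p` is computed in an arbitrary uniformizing chart `D` at an arbitrary
lift `x` of `p`. The map `κ` gives the coordinates `(q, p)` on the chart `C`, centred at `v₀`. -/
theorem mainTheorem7 {X : Type*} [TopologicalSpace X] (O : OrbifoldStructure X)
    (Ω : O.Form 2) (hΩ : Ω.IsSymplectic) (p : X)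
    (D : OrbifoldChart X) (hD : D ∈ O.charts)
    (x : D.Space) (hx : x ∈ D.V) (hxp : D.π x = p) :
    ∃ (C : O.charts) (v₀ : C.1.Space),
      v₀ ∈ C.1.V ∧ C.1.π v₀ = p ∧ (∀ g, C.1.act g v₀ = v₀) ∧
      Nonempty (C.1.G ≃* D.stabilizer x hx) ∧
      ∃ (n : ℕ) (κ : C.1.Space → Fin n ⊕ Fin n → ℝ),
        IsSmoothOpenEmbeddingOn κ C.1.V ∧ κ v₀ = 0 ∧
        (∀ v ∈ C.1.V, ∀ u w, Ω.form C v ![u, w] = darbouxForm κ v u w) ∧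
        ∃ S : C.1.G →* Matrix.symplecticGroup (Fin n) ℝ,
          ∀ g, ∀ v ∈ C.1.V,
            κ (C.1.act g v) = (S g : Matrix (Fin n ⊕ Fin n) (Fin n ⊕ Fin n) ℝ).mulVec (κ v) := by
  set D' : O.charts := ⟨D, hD⟩
  obtain ⟨N, n, κ, S, hN, hxN, -, hemb, hκ0, hform, hS⟩ :=
    (D.isSmoothActionFixing (H := D.stabilizer x hx) hx fun g hg => hg).exists_darboux_coordinates
      (Ω.smooth D') (fun g => Ω.invariant D' g) (hΩ.closed D') (hΩ.nondegenerate D' x hx)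
  obtain ⟨W, hW, hWN⟩ := D.exists_isSlice hx (hN.mem_nhds hxN)
  have hC : D.restrict hW ∈ O.charts := fun A hA => (hD A hA).restrict hW
  refine ⟨⟨D.restrict hW, hC⟩, x, hW.mem, hxp, fun g => g.2, ⟨MulEquiv.refl _⟩, n, κ,
    hemb W hW.isOpen hWN, hκ0, fun v hv u w => ?_, S, fun g v hv => hS g v (hWN hv)⟩
  -- The form on the restricted chart is separate data; compatibility with the inclusion, whose
  -- derivative is the identity, identifies it with the form on `D`.
  have h1 := Ω.compatible ⟨D.restrict hW, hC⟩ D' (OrbifoldChart.Embedding.ofSlice hW) v hv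
  have h2 : fderiv ℝ (OrbifoldChart.Embedding.ofSlice hW).toFun v =
      ContinuousLinearMap.id ℝ D.Space := fderiv_id
  rw [h2] at h1
  exact (congrArg (fun β => β ![u, w]) h1).symm.trans (hform v (hWN hv) u w)
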